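/- Let $F$ be a totally real number field of degree $g$ with ring of integers $\mathcal O_F$; let $\mathcal O_{F+}\subset\mathcal O_F$ be the set of totally positive integers and $\Delta$ the group of totally positive units of $\mathcal O_F$. Fix a numbering $\tau_1,\dots,\tau_g$ of the embeddings $F\hookrightarrow\mathbb R$, write $\alpha^{\tau_i}=\tau_i(\alpha)$, and view $F$ in $\mathbb R^g$ through $\alpha\mapsto(\alpha^{\tau_1},\dots,\alpha^{\tau_g})$. Let $A\subset\mathcal O_{F+}$ be the set of primitive elements, i.e. those $\alpha$ with $\alpha/N\notin\mathcal O_{F+}$ for every integer $N>1$. Let $\mathbb T=\mathrm{Hom}_{\mathbb Z}(\mathcal O_F,\mathbb G_m)=\mathrm{Spec}\,\mathbb Z[t^\alpha\mid\alpha\in\mathcal O_F]$ with $t^\alpha t^{\alpha'}=t^{\alpha+\alpha'}$, with the right action of $\Delta$ in which $[\varepsilon]\colon\mathbb T\to\mathbb T$ is given by $t^\alpha\mapsto t^{\varepsilon\alpha}$, and let $U=\mathbb T\setminus\{1\}$ be the complement of the identity section. For $\alpha\in\mathcal O_F$ put $U_\alpha=\mathbb T\setminus\{t^\alpha=1\}$;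 for a tuple $\boldsymbol\alpha=(\alpha_0,\dots,\alpha_q)\in A^{q+1}$ put $U_{\boldsymbol\alpha}=U_{\alpha_0}\cap\dots\cap U_{\alpha_q}\subset U$, with inclusion $j_{\boldsymbol\alpha}\colon U_{\boldsymbol\alpha}\hookrightarrow U$. Let $\mathfrak U=(U_\alpha)_{\alpha\in A}$. For a $\Delta$-equivariant sheaf $\mathcal F$ on $U$ put $\Gamma(U/\Delta,\mathcal F)=\Gamma(U,\mathcal F)^\Delta$, and let $H^m(U/\Delta,-)$ be the $m$-th right derived functor of $\Gamma(U/\Delta,-)$ on $\Delta$-equivariant sheaves of abelian groups. Let $\mathscr C^q(\mathfrak U,\mathcal F)\subset\prod_{\boldsymbol\alpha\in A^{q+1}}j_{\boldsymbol\alpha*}j_{\boldsymbol\alpha}^*\mathcal F$ be the equivariant subsheaf of alternating families ($s_{\rho(\boldsymbol\alpha)}=\mathrm{sgn}(\rho)s_{\boldsymbol\alpha}$ for every permutation $\rho$, and $s_{\boldsymbol\alpha}=0$ if two entries of $\boldsymbol\alpha$ coincide), where $\varepsilon\in\Delta$ acts by $(s_{\boldsymbol\alpha})\mapsto([\varepsilon]^*s_{\varepsilon^{-1}\boldsymbol\alpha})$.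 With the usual alternating-sum differentials $d^q$ these sheaves form a complex $\mathscr C^\bullet(\mathfrak U,\mathcal F)$, with augmentation $\mathcal F\to\mathscr C^\bullet(\mathfrak U,\mathcal F)$ given by restriction of sections. Put $C^\bullet(\mathfrak U/\Delta,\mathcal F)=\Gamma(U/\Delta,\mathscr C^\bullet(\mathfrak U,\mathcal F))$. A class $c\in H^m(U/\Delta,\mathcal F)$ is called the class of a cocycle $z\in C^m(\mathfrak U/\Delta,\mathcal F)$ if there are an injective resolution $\mathcal F\to\mathcal I^\bullet$ and a morphism of complexes $\mathscr C^\bullet(\mathfrak U,\mathcal F)\to\mathcal I^\bullet$ under $\mathcal F$ such that the induced map $H^m(C^\bullet(\mathfrak U/\Delta,\mathcal F))\to H^m(\Gamma(U/\Delta,\mathcal I^\bullet))=H^m(U/\Delta,\mathcal F)$ sends $[z]$ to $c$. For $\boldsymbol\alpha=(\alpha_1,\dots,\alpha_g)\in A^g$ let $P_{\boldsymbol\alpha}=\{x_1\alpha_1+\dots+x_g\alpha_g\mid 0\le x_i<1\}\subset\mathbb R^g$, and for $R\subset\mathbb R^g$ let $\widehat R$ be the set of $u\in\mathbb R_{>0}^g$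 for which there is $\delta>0$ with $(u_1,\dots,u_{g-1},u_g-\delta')\in R$ for all $0<\delta'<\delta$. Let $\mathrm{sgn}(\boldsymbol\alpha)\in\{0,\pm1\}$ be the sign of $\det(\alpha_j^{\tau_i})_{i,j}$ and put $$\mathcal G_{\sigma_{\boldsymbol\alpha}}(t)=\frac{\sum_{\beta\in\widehat P_{\boldsymbol\alpha}\cap\mathcal O_F}t^\beta}{(1-t^{\alpha_1})\cdots(1-t^{\alpha_g})},\qquad \mathcal G_{\boldsymbol\alpha}=\mathrm{sgn}(\boldsymbol\alpha)\,\mathcal G_{\sigma_{\boldsymbol\alpha}}(t)\in\Gamma(U_{\boldsymbol\alpha},\mathcal O_{\mathbb T}).$$ Then: 1. $(\mathcal G_{\boldsymbol\alpha})_{\boldsymbol\alpha\in A^g}$ is alternating and $\Delta$-invariant, i.e. it is an element of $C^{g-1}(\mathfrak U/\Delta,\mathcal O_{\mathbb T})$. 2. It satisfies the cocycle condition $d^{g-1}(\mathcal G_{\boldsymbol\alpha})=0$. 3. Hence it defines a class: there is exactly one $\mathcal G\in H^{g-1}(U/\Delta,\mathcal O_{\mathbb T})$ that is the class of the cocycle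 $(\mathcal G_{\boldsymbol\alpha})$. It is called the Shintani generating class. -/

import Mathlib

namespace Shintani

open CategoryTheory AlgebraicGeometry Opposite

universe u

/-- A right action of a group `G` on a scheme `X`: endomorphisms `[g]` of `X` with `[1] = id` and
`[a b] = [b] ∘ [a]` (composition `≫` is written in diagrammatic order). -/
structure RightAction (G : Type u) [Group G] (X : Scheme.{u}) where
  act : G → (X ⟶ X)
  act_one : act 1 = 𝟙 X
  act_mul : ∀ a b : G, act (a * b) = act a ≫ act b

/-- Objects of the site of `X/G`: the open subsets of `X`. A morphism `V ⟶ W` is an element `g` of `G`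
with `[g](V) ⊆ W`; the morphism `g` followed by the morphism `h` is `g * h`.
A presheaf `P` on this category is a presheaf on `X` (restrict to the morphisms with `g = 1`)
together with pullback maps `[g]^* : P(W) → P([g]⁻¹ W)` satisfying `[1]^* = id` and
`[a b]^* = [a]^* [b]^*`, that is, with a `G`-equivariant structure `[g]^* P ≅ P`. -/
@[ext]
structure QOpen {G : Type u} [Group G] {X : Scheme.{u}} (ρ : RightAction G X) where
  carrier : X.Opens

section Site

variable {G : Type u} [Group G] {X : Scheme.{u}} {ρ : RightAction G X}

instance : SmallCategory.{u} (QOpen ρ) where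
  Hom V W := {g : G // V.carrier ≤ (ρ.act g) ⁻¹ᵁ W.carrier}
  id V := ⟨1, by rw [ρ.act_one]; exact le_rfl⟩
  comp f h := ⟨f.1 * h.1, by
    rw [ρ.act_mul]
    exact fun x hx => h.2 (f.2 hx)⟩
  id_comp f := Subtype.ext (one_mul _)
  comp_id f := Subtype.ext (mul_one _)
  assoc f g h := Subtype.ext (mul_assoc _ _ _)

namespace QOpen

/-- The group element underlying a morphism. -/
def elt {V W : QOpen ρ} (f : V ⟶ W) : G := f.1

lemma le_preimage {V W : QOpen ρ} (f : V ⟶ W) :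
    V.carrier ≤ (ρ.act (elt f)) ⁻¹ᵁ W.carrier := f.2

/-- The morphism `V ⟶ W` given by a group element `g` with `[g](V) ⊆ W`. -/
def mkHom {V W : QOpen ρ} (g : G) (h : V.carrier ≤ (ρ.act g) ⁻¹ᵁ W.carrier) : V ⟶ W := ⟨g, h⟩

/-- The inclusion morphism `V ⟶ W` for `V ⊆ W`. -/
def incl {V W : QOpen ρ} (h : V.carrier ≤ W.carrier) : V ⟶ W :=
  mkHom 1 (by rw [ρ.act_one]; exact h)

@[ext]
lemma hom_ext {V W : QOpen ρ} {f f' : V ⟶ W} (h : elt f = elt f') : f = f' := Subtype.ext h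

@[simp] lemma elt_id (V : QOpen ρ) : elt (𝟙 V) = 1 := rfl

@[simp] lemma elt_comp {V W T : QOpen ρ} (f : V ⟶ W) (h : W ⟶ T) :
    elt (f ≫ h) = elt f * elt h := rfl

@[simp] lemma elt_mkHom {V W : QOpen ρ} (g : G) (h : V.carrier ≤ (ρ.act g) ⁻¹ᵁ W.carrier) :
    elt (mkHom g h) = g := rfl

@[simp] lemma elt_incl {V W : QOpen ρ} (h : V.carrier ≤ W.carrier) : elt (incl h) = 1 := rfl

end QOpen

open QOpen

variable (ρ) in
lemma act_inv_act (g : G) (x : X) : (ρ.act g⁻¹) ((ρ.act g) x) = x := by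
  have := ρ.act_mul g g⁻¹
  rw [mul_inv_cancel, ρ.act_one] at this
  exact (congrArg (fun f : X ⟶ X => f x) this).symm

variable (ρ) in
lemma act_act_inv (g : G) (x : X) : (ρ.act g) ((ρ.act g⁻¹) x) = x := by
  have := ρ.act_mul g⁻¹ g
  rw [inv_mul_cancel, ρ.act_one] at this
  exact (congrArg (fun f : X ⟶ X => f x) this).symm

variable (ρ) in
lemma act_mul_apply (g h : G) (x : X) : (ρ.act (g * h)) x = (ρ.act h) ((ρ.act g) x) := by
  rw [ρ.act_mul]; rfl

variable (ρ) in
lemma act_one_apply (x : X) : (ρ.act 1) x = x := by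
  rw [ρ.act_one]; rfl

variable (ρ) in
/-- The topology of the site of `X/G`: a sieve on `V` covers if the images `[g](W) ⊆ V` of its
members `g : W ⟶ V` cover `V`. Sheaves of abelian groups for this topology are exactly the
`G`-equivariant sheaves of abelian groups on `X`. -/
def topology : GrothendieckTopology (QOpen ρ) where
  sieves V := {S | ∀ x ∈ V.carrier, ∃ (W : QOpen ρ) (f : W ⟶ V), S f ∧
    ∃ y ∈ W.carrier, (ρ.act (elt f)) y = x}
  top_mem' V x hx := ⟨V, 𝟙 V, trivial, x, hx, act_one_apply ρ x⟩
  pullback_stable' := by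
    intro V V' S h hS x hx
    obtain ⟨W, f, hf, y, hy, hyx⟩ := hS _ (le_preimage h hx)
    refine ⟨⟨V'.carrier ⊓ (ρ.act (elt h * (elt f)⁻¹)) ⁻¹ᵁ W.carrier⟩,
      incl inf_le_left, ?_, x, ⟨hx, ?_⟩, act_one_apply ρ x⟩
    · have : (incl inf_le_left : (⟨V'.carrier ⊓ (ρ.act (elt h * (elt f)⁻¹)) ⁻¹ᵁ W.carrier⟩ :
          QOpen ρ) ⟶ V') ≫ h = mkHom (elt h * (elt f)⁻¹) inf_le_right ≫ f := by
        ext; simp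
      change S _
      rw [this]
      exact S.downward_closed hf _
    · change (ρ.act (elt h * (elt f)⁻¹)) x ∈ W.carrier
      rw [act_mul_apply, ← hyx, act_inv_act]
      exact hy
  transitive' := by
    intro V S hS R hR x hx
    obtain ⟨W, f, hf, y, hy, hyx⟩ := hS x hx
    obtain ⟨T, h, hh, z, hz, hzy⟩ := hR hf y hy
    exact ⟨T, h ≫ f, hh, z, hz, by rw [elt_comp, act_mul_apply, hzy, hyx]⟩

/-- Pullback of sections `P(W) → P(V)` along a morphism `V ⟶ W`. -/
def pull (P : (QOpen ρ)ᵒᵖ ⥤ AddCommGrpCat.{u}) {V W : QOpen ρ} (f : V ⟶ W) :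
    P.obj (op W) →+ P.obj (op V) := (P.map f.op).hom

lemma pull_id (P : (QOpen ρ)ᵒᵖ ⥤ AddCommGrpCat.{u}) (V : QOpen ρ) (s : P.obj (op V)) :
    pull P (𝟙 V) s = s := by
  have := P.map_id (op V)
  exact congrArg (fun φ : P.obj (op V) ⟶ P.obj (op V) => φ.hom s) this

lemma pull_comp (P : (QOpen ρ)ᵒᵖ ⥤ AddCommGrpCat.{u}) {V W T : QOpen ρ} (f : V ⟶ W)
    (h : W ⟶ T) (s : P.obj (op T)) : pull P (f ≫ h) s = pull P f (pull P h s) := by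
  have := P.map_comp h.op f.op
  exact congrArg (fun φ : P.obj (op T) ⟶ P.obj (op V) => φ.hom s) this

/-- The presheaf `V ↦ Γ(V, 𝒪_X)` with the pullback of functions
`[g]^* : Γ(W, 𝒪_X) → Γ(V, 𝒪_X)` along `[g] : V → W`. -/
def structurePresheaf (ρ : RightAction G X) : (QOpen ρ)ᵒᵖ ⥤ AddCommGrpCat.{u} where
  obj V := AddCommGrpCat.of Γ(X, V.unop.carrier)
  map {W V} f := AddCommGrpCat.ofHom
    ((ρ.act (elt f.unop)).appLE W.unop.carrier V.unop.carrier (le_preimage f.unop)).hom.toAddMonoidHom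
  map_id V := by
    ext s
    change (ρ.act 1).appLE _ _ _ s = s
    have : ∀ (φ : X ⟶ X) (h : φ = 𝟙 X) (e), φ.appLE V.unop.carrier V.unop.carrier e s = s := by
      rintro _ rfl e
      have he : (homOfLE e).op = 𝟙 (op V.unop.carrier) := rfl
      simp only [Scheme.Hom.appLE, Scheme.Hom.id_app]
      erw [he, X.presheaf.map_id]
      rfl
    exact this _ ρ.act_one _
  map_comp {W V T} f h := by
    ext s
    change (ρ.act (elt h.unop * elt f.unop)).appLE _ _ _ s =
      (ρ.act (elt h.unop)).appLE _ _ _ ((ρ.act (elt f.unop)).appLE _ _ _ s)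
    rw [← CommRingCat.comp_apply, Scheme.Hom.appLE_comp_appLE]
    congr 2
    simp only [ρ.act_mul]

/-- The sheaf condition follows from unique gluing of compatible families of sections. -/
lemma isSheaf_of_gluing (P : (QOpen ρ)ᵒᵖ ⥤ AddCommGrpCat.{u})
    (h : ∀ (V : QOpen ρ) (S : Sieve V), S ∈ topology ρ V →
      ∀ x : (∀ (W : QOpen ρ) (f : W ⟶ V), S f → P.obj (op W)),
        (∀ (W T : QOpen ρ) (f : W ⟶ V) (hf : S f) (k : T ⟶ W),
          pull P k (x W f hf) = x T (k ≫ f) (S.downward_closed hf k)) →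
        ∃! s : P.obj (op V), ∀ (W : QOpen ρ) (f : W ⟶ V) (hf : S f), pull P f s = x W f hf) :
    Presheaf.IsSheaf (topology ρ) P := by
  rw [Presheaf.isSheaf_iff_isSheaf_forget (J := topology ρ) (s := forget AddCommGrpCat.{u}),
    isSheaf_iff_isSheaf_of_type]
  intro V S hS x hx
  rw [Presieve.compatible_iff_sieveCompatible] at hx
  obtain ⟨s, hs, hu⟩ := h V S hS (fun W f hf => x f hf)
    (fun W T f hf k => (hx f k hf).symm)
  exact ⟨s, fun W f hf => hs W f hf, fun t ht => hu t fun W f hf => ht f hf⟩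

/-- Unique gluing of compatible families of sections of a sheaf. -/
lemma existsUnique_gluing (F : Sheaf (topology ρ) AddCommGrpCat.{u})
    (V : QOpen ρ) (S : Sieve V) (hS : S ∈ topology ρ V)
    (x : ∀ (W : QOpen ρ) (f : W ⟶ V), S f → F.obj.obj (op W))
    (hx : ∀ (W T : QOpen ρ) (f : W ⟶ V) (hf : S f) (k : T ⟶ W),
      pull F.obj k (x W f hf) = x T (k ≫ f) (S.downward_closed hf k)) :
    ∃! s : F.obj.obj (op V), ∀ (W : QOpen ρ) (f : W ⟶ V) (hf : S f),
      pull F.obj f s = x W f hf := by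
  have h := F.property
  rw [Presheaf.isSheaf_iff_isSheaf_forget (J := topology ρ) (s := forget AddCommGrpCat.{u}),
    isSheaf_iff_isSheaf_of_type] at h
  let x' : Presieve.FamilyOfElements (F.obj ⋙ forget AddCommGrpCat.{u}) S.arrows :=
    fun W f hf => x W f hf
  have hx' : x'.Compatible :=
    (Presieve.compatible_iff_sieveCompatible x').2 fun W T f k hf => (hx W T f hf k).symm
  obtain ⟨s, hs, hu⟩ := h S hS x' hx'
  exact ⟨s, fun W f hf => hs f hf, fun t ht => hu t fun W f hf => ht W f hf⟩

lemma pull_structurePresheaf_incl {V W : QOpen ρ} (h : V.carrier ≤ W.carrier)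
    (s : Γ(X, W.carrier)) :
    pull (structurePresheaf ρ) (incl h) s = X.presheaf.map (homOfLE h).op s := by
  change (ρ.act 1).appLE _ _ _ s = _
  have : ∀ (φ : X ⟶ X) (_ : φ = 𝟙 X) (e),
      φ.appLE W.carrier V.carrier e s = X.presheaf.map (homOfLE h).op s := by
    rintro _ rfl e
    simp only [Scheme.Hom.appLE, Scheme.Hom.id_app]
    rfl
  exact this _ ρ.act_one _

lemma structurePresheaf_isSheaf : Presheaf.IsSheaf (topology ρ) (structurePresheaf ρ) := by
  apply isSheaf_of_gluing
  intro V S hS x hx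
  let ι := {W : QOpen ρ // ∃ h : W.carrier ≤ V.carrier, S (incl h)}
  have hcov : V.carrier ≤ ⨆ i : ι, i.1.carrier := by
    intro p hp
    obtain ⟨W, f, hf, y, hy, rfl⟩ := hS p hp
    let T : QOpen ρ := ⟨(ρ.act (elt f)⁻¹) ⁻¹ᵁ W.carrier⟩
    have hTV : T.carrier ≤ V.carrier := by
      intro z hz
      have := le_preimage f hz
      change (ρ.act (elt f)) ((ρ.act (elt f)⁻¹) z) ∈ V.carrier at this
      rwa [act_act_inv] at this
    have e : (incl hTV : T ⟶ V) = mkHom (elt f)⁻¹ le_rfl ≫ f := by ext; simp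
    refine TopologicalSpace.Opens.mem_iSup.2
      ⟨⟨T, hTV, by rw [e]; exact S.downward_closed hf _⟩, ?_⟩
    change (ρ.act (elt f)⁻¹) ((ρ.act (elt f)) y) ∈ W.carrier
    rwa [act_inv_act]
  obtain ⟨s, hs, hu⟩ := X.sheaf.existsUnique_gluing' (fun i : ι => i.1.carrier) V.carrier
    (fun i => homOfLE i.2.1) hcov (fun i => x i.1 (incl i.2.1) i.2.2) (by
      intro i j
      let T : QOpen ρ := ⟨i.1.carrier ⊓ j.1.carrier⟩
      have h1 := hx i.1 T (incl i.2.1) i.2.2 (incl inf_le_left)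
      have h2 := hx j.1 T (incl j.2.1) j.2.2 (incl inf_le_right)
      refine ((pull_structurePresheaf_incl inf_le_left _).symm.trans h1).trans (Eq.trans ?_
        (h2.symm.trans (pull_structurePresheaf_incl inf_le_right _)))
      congr 1)
  refine ⟨s, ?_, ?_⟩
  · intro W f hf
    let T : QOpen ρ := ⟨(ρ.act (elt f)⁻¹) ⁻¹ᵁ W.carrier⟩
    have hTV : T.carrier ≤ V.carrier := by
      intro z hz
      have := le_preimage f hz
      change (ρ.act (elt f)) ((ρ.act (elt f)⁻¹) z) ∈ V.carrier at this
      rwa [act_act_inv] at this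
    have e : (incl hTV : T ⟶ V) = mkHom (elt f)⁻¹ le_rfl ≫ f := by ext; simp
    let k : W ⟶ T := mkHom (elt f) (by
      intro z hz
      change (ρ.act (elt f)⁻¹) ((ρ.act (elt f)) z) ∈ W.carrier
      rwa [act_inv_act])
    have e' : k ≫ incl hTV = f := by ext; simp [k]
    have hT : S (incl hTV) := by rw [e]; exact S.downward_closed hf _
    have h1 : pull (structurePresheaf ρ) (incl hTV) s = x T (incl hTV) hT :=
      (pull_structurePresheaf_incl hTV s).trans (hs ⟨T, hTV, hT⟩)
    have h2 := hx T W (incl hTV) hT k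
    have h3 : ∀ (f' : W ⟶ V) (hf' : S f'), f' = k ≫ incl hTV →
        pull (structurePresheaf ρ) f' s = x W f' hf' := by
      rintro _ hf' rfl
      exact (pull_comp (structurePresheaf ρ) k (incl hTV) s).trans ((congrArg _ h1).trans h2)
    exact h3 f hf e'.symm
  · intro t ht
    refine hu t fun i => ?_
    have := ht i.1 (incl i.2.1) i.2.2
    exact (pull_structurePresheaf_incl i.2.1 t).symm.trans this

end Site

section AlternatingSums

variable {B A M : Type*} [AddCommGroup M]

/-- Cancellation in the double alternating sum over faces. -/
lemma altSum_altSum {q : ℕ} (Φ : (Fin q → Fin (q + 2)) → M) :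
    ∑ j : Fin (q + 2), (-1 : ℤ) ^ (j : ℕ) • ∑ i : Fin (q + 1),
      (-1 : ℤ) ^ (i : ℕ) • Φ (j.succAbove ∘ i.succAbove) = 0 := by
  simp only [Finset.smul_sum, smul_smul, ← pow_add]
  rw [← Finset.sum_product' (f := fun (j : Fin (q + 2)) (i : Fin (q + 1)) =>
    (-1 : ℤ) ^ ((j : ℕ) + (i : ℕ)) • Φ (j.succAbove ∘ i.succAbove))]
  refine Finset.sum_involution (fun p _ => (p.1.succAbove p.2, p.2.predAbove p.1)) ?_ ?_ ?_ ?_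
  · rintro ⟨j, i⟩ -
    have h : ((j.succAbove i).succAbove ∘ (i.predAbove j).succAbove : Fin q → Fin (q + 2)) =
        j.succAbove ∘ i.succAbove :=
      funext fun k => Fin.succAbove_succAbove_succAbove_predAbove j i k
    dsimp only
    rw [h, Fin.neg_one_pow_succAbove_add_predAbove, neg_smul, add_neg_cancel]
  · rintro ⟨j, i⟩ - - h
    exact Fin.succAbove_ne j i (congrArg Prod.fst h)
  · intros; simp
  · rintro ⟨j, i⟩ -
    refine Prod.ext (Fin.succAbove_succAbove_predAbove j i) ?_
    apply (Fin.succAbove_right_injective (p := j))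
    have := Fin.succAbove_succAbove_predAbove (j.succAbove i) (i.predAbove j)
    dsimp only at this ⊢
    rwa [Fin.succAbove_succAbove_predAbove j i] at this

lemma altSum_comp_perm {q : ℕ} (Φ : (Fin (q + 1) → B) → M)
    (hΦ : ∀ (σ : Equiv.Perm (Fin (q + 1))) (β : Fin (q + 1) → B),
      Φ (β ∘ σ) = ((Equiv.Perm.sign σ : ℤˣ) : ℤ) • Φ β)
    (σ : Equiv.Perm (Fin (q + 2))) (γ : Fin (q + 2) → B) :
    ∑ j : Fin (q + 2), (-1 : ℤ) ^ (j : ℕ) • Φ ((γ ∘ σ) ∘ j.succAbove) =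
      ((Equiv.Perm.sign σ : ℤˣ) : ℤ) • ∑ j : Fin (q + 2), (-1 : ℤ) ^ (j : ℕ) •
        Φ (γ ∘ j.succAbove) := by
  rw [Finset.smul_sum, ← Equiv.sum_comp σ (fun j : Fin (q + 2) =>
    ((Equiv.Perm.sign σ : ℤˣ) : ℤ) • (-1 : ℤ) ^ (j : ℕ) • Φ (γ ∘ j.succAbove))]
  refine Finset.sum_congr rfl fun j _ => ?_
  let σ' : Equiv.Perm (Fin (q + 2)) := (j.cycleRange.symm.trans σ).trans (σ j).cycleRange
  have h0 : σ' 0 = 0 := by simp [σ']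
  obtain ⟨⟨p, e⟩, he⟩ := Equiv.Perm.decomposeFin.symm.surjective σ'
  have hp : p = 0 := by
    rw [← h0, ← he, Equiv.Perm.decomposeFin_symm_apply_zero]
  subst hp
  have hs : Equiv.Perm.sign σ' = Equiv.Perm.sign e := by
    rw [← he, Equiv.Perm.decomposeFin.symm_sign]; simp
  have hk : ∀ k, σ (j.succAbove k) = (σ j).succAbove (e k) := by
    intro k
    have h1 : σ' k.succ = (e k).succ := by
      rw [← he, Equiv.Perm.decomposeFin_symm_apply_succ]; simp
    have h2 : (σ j).cycleRange (σ (j.succAbove k)) = (e k).succ := by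
      rw [← h1]; simp [σ']
    rw [← Fin.cycleRange_symm_succ (σ j), ← h2, Equiv.symm_apply_apply]
  have hfun : (γ ∘ σ) ∘ j.succAbove = (γ ∘ (σ j).succAbove) ∘ e :=
    funext fun k => congrArg γ (hk k)
  have hsign : Equiv.Perm.sign σ' =
      Equiv.Perm.sign σ * (-1) ^ (j : ℕ) * (-1) ^ ((σ j : Fin (q + 2)) : ℕ) := by
    have : σ' = (σ j).cycleRange * (σ * j.cycleRange.symm) := rfl
    rw [this, Equiv.Perm.sign_mul, Equiv.Perm.sign_mul, Equiv.Perm.sign_symm,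
      Fin.sign_cycleRange, Fin.sign_cycleRange]
    exact mul_comm _ _
  rw [hfun, hΦ, ← hs, hsign, smul_smul, smul_smul]
  congr 1
  push_cast
  have : ((-1 : ℤ) ^ (j : ℕ)) * (-1) ^ (j : ℕ) = 1 := by
    rw [← mul_pow]; simp
  linear_combination (((Equiv.Perm.sign σ : ℤˣ) : ℤ) * (-1) ^ ((σ j : Fin (q + 2)) : ℕ)) * this

lemma altSum_eq_zero {q : ℕ} (Φ : (Fin (q + 1) → B) → M) (α : B → A)
    (hΦ : ∀ (σ : Equiv.Perm (Fin (q + 1))) (β : Fin (q + 1) → B),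
      Φ (β ∘ σ) = ((Equiv.Perm.sign σ : ℤˣ) : ℤ) • Φ β)
    (hΦ' : ∀ β β' : Fin (q + 1) → B, α ∘ β = α ∘ β' → Φ β = Φ β')
    (hΦ0 : ∀ β : Fin (q + 1) → B, ¬ Function.Injective (α ∘ β) → Φ β = 0)
    (γ : Fin (q + 2) → B) (hγ : ¬ Function.Injective (α ∘ γ)) :
    ∑ j : Fin (q + 2), (-1 : ℤ) ^ (j : ℕ) • Φ (γ ∘ j.succAbove) = 0 := by
  have key : ∀ γ : Fin (q + 2) → B, α (γ 0) = α (γ 1) →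
      ∑ j : Fin (q + 2), (-1 : ℤ) ^ (j : ℕ) • Φ (γ ∘ j.succAbove) = 0 := by
    intro γ h01
    rw [Fintype.sum_eq_add (0 : Fin (q + 2)) 1 (by simp)]
    · have : Φ (γ ∘ (0 : Fin (q + 2)).succAbove) = Φ (γ ∘ (1 : Fin (q + 2)).succAbove) := by
        apply hΦ'
        funext k
        cases k using Fin.cases with
        | zero => simpa using h01.symm
        | succ k =>
          simp only [Function.comp_apply, Fin.succAbove_zero]
          rw [← Fin.succ_zero_eq_one, Fin.succ_succAbove_succ, Fin.succAbove_zero]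
      rw [this]; simp
    · rintro k ⟨hk0, hk1⟩
      obtain ⟨i, hi⟩ := Fin.exists_succAbove_eq hk0.symm
      obtain ⟨j, hj⟩ := Fin.exists_succAbove_eq hk1.symm
      rw [hΦ0, smul_zero]
      intro hinj
      have : i = j := hinj (by simpa [hi, hj] using h01)
      subst this
      exact absurd (hi.symm.trans hj) (by simp)
  obtain ⟨i, j, hij, hne⟩ : ∃ i j, α (γ i) = α (γ j) ∧ i ≠ j := by
    simpa [Function.Injective] using hγ
  obtain ⟨σ, h0, h1⟩ : ∃ σ : Equiv.Perm (Fin (q + 2)), σ 0 = i ∧ σ 1 = j := by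
    refine ⟨(Equiv.swap 0 i).trans (Equiv.swap (Equiv.swap 0 i 1) j), ?_, ?_⟩
    · rw [Equiv.trans_apply, Equiv.swap_apply_left]
      refine Equiv.swap_apply_of_ne_of_ne ?_ hne
      intro h
      have := congrArg (Equiv.swap (0 : Fin (q + 2)) i) h
      rw [Equiv.swap_apply_right, Equiv.swap_apply_self] at this
      exact absurd this (by simp)
    · rw [Equiv.trans_apply, Equiv.swap_apply_left]
  have h := altSum_comp_perm Φ hΦ σ γ
  rw [key (γ ∘ σ) (by simpa [h0, h1] using hij)] at h
  rcases Int.units_eq_one_or (Equiv.Perm.sign σ) with hs | hs <;> rw [hs] at h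
  · simpa using h.symm
  · simpa using h.symm

end AlternatingSums

/-- A family of open subsets `U_a` of `X`, indexed by a `G`-set `A`, with `U_{g a} = [g]⁻¹ U_a`. -/
structure EquivariantFamily {G : Type u} [Group G] {X : Scheme.{u}} (ρ : RightAction G X)
    (A : Type u) [MulAction G A] where
  opens : A → X.Opens
  opens_smul : ∀ (g : G) (a : A), opens (g • a) = (ρ.act g) ⁻¹ᵁ (opens a)

section Cech

variable {G : Type u} [Group G] {X : Scheme.{u}} {ρ : RightAction G X}
  {A : Type u} [MulAction G A]

open QOpen

namespace EquivariantFamily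

variable (𝔘 : EquivariantFamily ρ A)

/-- The intersection `U_{α_0} ∩ ⋯ ∩ U_{α_{k-1}}`. -/
def inter {k : ℕ} (α : Fin k → A) : X.Opens := ⨅ i, 𝔘.opens (α i)

lemma mem_inter {k : ℕ} (α : Fin k → A) (x : X) :
    x ∈ 𝔘.inter α ↔ ∀ i, x ∈ 𝔘.opens (α i) := by
  rw [← SetLike.mem_coe, inter, TopologicalSpace.Opens.coe_iInf]
  simp

/-- The open subset `V ∩ U_α` of `X`. -/
def box (V : QOpen ρ) {k : ℕ} (α : Fin k → A) : QOpen ρ := ⟨V.carrier ⊓ 𝔘.inter α⟩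

lemma box_le_comp (V : QOpen ρ) {k l : ℕ} (α : Fin k → A) (β : Fin l → Fin k) :
    (𝔘.box V α).carrier ≤ (𝔘.box V (α ∘ β)).carrier := fun _ hx =>
  ⟨hx.1, (𝔘.mem_inter _ _).2 fun i => (𝔘.mem_inter _ _).1 hx.2 (β i)⟩

lemma box_le (V : QOpen ρ) {k : ℕ} (α : Fin k → A) : (𝔘.box V α).carrier ≤ V.carrier :=
  fun _ hx => hx.1

lemma box_le_preimage {V W : QOpen ρ} (f : V ⟶ W) {k : ℕ} (α : Fin k → A) :
    (𝔘.box V α).carrier ≤ (ρ.act (elt f)) ⁻¹ᵁ (𝔘.box W ((elt f)⁻¹ • α)).carrier := by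
  intro x hx
  refine ⟨le_preimage f hx.1, (𝔘.mem_inter _ _).2 fun i => ?_⟩
  have := (𝔘.mem_inter _ _).1 hx.2 i
  rw [← smul_inv_smul (elt f) (α i), 𝔘.opens_smul] at this
  exact this

/-- For `f : V ⟶ W` with group element `g`, the morphism `V ∩ U_α ⟶ W ∩ U_{g⁻¹ α}` given by `g`. -/
def boxHom {V W : QOpen ρ} (f : V ⟶ W) {k : ℕ} (α : Fin k → A) :
    𝔘.box V α ⟶ 𝔘.box W ((elt f)⁻¹ • α) := mkHom (elt f) (𝔘.box_le_preimage f α)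

@[simp] lemma elt_boxHom {V W : QOpen ρ} (f : V ⟶ W) {k : ℕ} (α : Fin k → A) :
    elt (𝔘.boxHom f α) = elt f := rfl

lemma pull_congr (P : (QOpen ρ)ᵒᵖ ⥤ AddCommGrpCat.{u}) {V T : QOpen ρ} {k : ℕ}
    (s : ∀ α : Fin k → A, P.obj (op (𝔘.box V α))) {α α' : Fin k → A} (h : α = α')
    (f : T ⟶ 𝔘.box V α) (f' : T ⟶ 𝔘.box V α') (hf : elt f = elt f') :
    pull P f (s α) = pull P f' (s α') := by
  subst h
  rw [hom_ext hf]

/-- Alternating cochains over `V`: families `s_α ∈ P(V ∩ U_α)`, indexed by all `(q+1)`-tuples `α` in `A`,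
with `s_{σ(α)} = sgn(σ) s_α` for all permutations `σ`, and `s_α = 0` if two entries of `α` coincide. -/
def cochains (P : (QOpen ρ)ᵒᵖ ⥤ AddCommGrpCat.{u}) (q : ℕ) (V : QOpen ρ) :
    AddSubgroup (∀ α : Fin (q + 1) → A, P.obj (op (𝔘.box V α))) where
  carrier := {s | (∀ (σ : Equiv.Perm (Fin (q + 1))) (α : Fin (q + 1) → A),
      pull P (incl (𝔘.box_le_comp V α σ)) (s (α ∘ σ)) =
        ((Equiv.Perm.sign σ : ℤˣ) : ℤ) • s α) ∧
    ∀ α : Fin (q + 1) → A, ¬ Function.Injective α → s α = 0}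
  zero_mem' := ⟨fun σ α => by simp, fun _ _ => rfl⟩
  add_mem' := fun {s t} hs ht => ⟨fun σ α => by
      rw [Pi.add_apply, Pi.add_apply, map_add, hs.1, ht.1, smul_add],
    fun α hα => by rw [Pi.add_apply, hs.2 α hα, ht.2 α hα, add_zero]⟩
  neg_mem' := fun {s} hs => ⟨fun σ α => by
      rw [Pi.neg_apply, Pi.neg_apply, map_neg, hs.1, smul_neg],
    fun α hα => by rw [Pi.neg_apply, hs.2 α hα, neg_zero]⟩

/-- The equivariant structure on cochains: `s` is mapped to the family `([g]^* s_{g⁻¹ α})_α`. -/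
def cochainsPull (P : (QOpen ρ)ᵒᵖ ⥤ AddCommGrpCat.{u}) (q : ℕ) {V W : QOpen ρ} (f : V ⟶ W) :
    𝔘.cochains P q W →+ 𝔘.cochains P q V where
  toFun s := ⟨fun α => pull P (𝔘.boxHom f α) (s.1 ((elt f)⁻¹ • α)), by
    refine ⟨fun σ α => ?_, fun α hα => ?_⟩
    · rw [← map_zsmul, ← s.2.1, ← pull_comp, ← pull_comp]
      exact 𝔘.pull_congr P s.1 rfl _ _ (by simp)
    · change pull P (𝔘.boxHom f α) (s.1 ((elt f)⁻¹ • α)) = 0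
      rw [s.2.2, map_zero]
      intro h
      exact hα fun i j hij => h (by simp [hij])⟩
  map_zero' := Subtype.ext (funext fun α => map_zero _)
  map_add' s t := Subtype.ext (funext fun α => map_add _ _ _)

/-- The alternating Čech presheaf `∏^alt_α j_{α*} j_α^* P`. -/
def cechPresheaf (P : (QOpen ρ)ᵒᵖ ⥤ AddCommGrpCat.{u}) (q : ℕ) :
    (QOpen ρ)ᵒᵖ ⥤ AddCommGrpCat.{u} where
  obj V := AddCommGrpCat.of (𝔘.cochains P q V.unop)
  map f := AddCommGrpCat.ofHom (𝔘.cochainsPull P q f.unop)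
  map_id V := by
    refine AddCommGrpCat.hom_ext (AddMonoidHom.ext fun s => ?_)
    refine Subtype.ext (funext fun α => ?_)
    change pull P (𝔘.boxHom (𝟙 V.unop) α) (s.1 ((1 : G)⁻¹ • α)) = s.1 α
    exact (𝔘.pull_congr P s.1 (α := (1 : G)⁻¹ • α) (α' := α) (by simp)
      (𝔘.boxHom (𝟙 V.unop) α) (𝟙 _)
      ((𝔘.elt_boxHom _ _).trans ((elt_id _).trans (elt_id _).symm))).trans (pull_id P _ _)
  map_comp {W V T} f h := by
    refine AddCommGrpCat.hom_ext (AddMonoidHom.ext fun s => ?_)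
    refine Subtype.ext (funext fun α => ?_)
    change pull P (𝔘.boxHom (h.unop ≫ f.unop) α) (s.1 ((elt h.unop * elt f.unop)⁻¹ • α)) =
      pull P (𝔘.boxHom h.unop α) (pull P (𝔘.boxHom f.unop ((elt h.unop)⁻¹ • α))
        (s.1 ((elt f.unop)⁻¹ • (elt h.unop)⁻¹ • α)))
    rw [← pull_comp]
    exact 𝔘.pull_congr P s.1 (by
      change (elt h.unop * elt f.unop)⁻¹ • α = _
      rw [mul_inv_rev, mul_smul]) _ _
      ((𝔘.elt_boxHom _ _).trans (elt_comp (𝔘.boxHom h.unop α) (𝔘.boxHom f.unop _)).symm)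

lemma cechPresheaf_pull_apply (P : (QOpen ρ)ᵒᵖ ⥤ AddCommGrpCat.{u}) (q : ℕ) {V W : QOpen ρ}
    (f : V ⟶ W) (s : 𝔘.cochains P q W) (α : Fin (q + 1) → A) :
    (show 𝔘.cochains P q V from pull (𝔘.cechPresheaf P q) f s).1 α =
      pull P (𝔘.boxHom f α) (s.1 ((elt f)⁻¹ • α)) := rfl

lemma cechPresheaf_isSheaf (F : Sheaf (topology ρ) AddCommGrpCat.{u}) (q : ℕ) :
    Presheaf.IsSheaf (topology ρ) (𝔘.cechPresheaf F.obj q) := by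
  apply isSheaf_of_gluing
  intro V S hS x hx
  let x' : ∀ (W : QOpen ρ) (f : W ⟶ V), S f → 𝔘.cochains F.obj q W := fun W f hf => x W f hf
  have hx' : ∀ (W T : QOpen ρ) (f : W ⟶ V) (hf : S f) (k : T ⟶ W) (α : Fin (q + 1) → A),
      pull F.obj (𝔘.boxHom k α) ((x' W f hf).1 ((elt k)⁻¹ • α)) =
        (x' T (k ≫ f) (S.downward_closed hf k)).1 α := fun W T f hf k α =>
    congrArg (fun t : 𝔘.cochains F.obj q T => t.1 α) (hx W T f hf k)
  have hle : ∀ (α : Fin (q + 1) → A) (W : QOpen ρ) (f : W ⟶ 𝔘.box V α),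
      W.carrier ≤ (𝔘.box W (elt f • α)).carrier := by
    intro α W f y hy
    refine ⟨hy, (𝔘.mem_inter _ _).2 fun i => ?_⟩
    rw [Pi.smul_apply, 𝔘.opens_smul]
    exact (𝔘.mem_inter _ _).1 (le_preimage f hy).2 i
  have hcongr : ∀ (T : QOpen ρ) (f f' : T ⟶ V) (_ : f = f') (hf : S f) (hf' : S f')
      (β : Fin (q + 1) → A) (hb : T.carrier ≤ (𝔘.box T β).carrier),
      pull F.obj (incl hb) ((x' T f hf).1 β) = pull F.obj (incl hb) ((x' T f' hf').1 β) := by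
    rintro T f _ rfl hf hf' β hb
    rfl
  have hglue : ∀ α : Fin (q + 1) → A, ∃! s : F.obj.obj (op (𝔘.box V α)),
      ∀ (W : QOpen ρ) (f : W ⟶ 𝔘.box V α) (hf : S (f ≫ incl (𝔘.box_le V α))),
        pull F.obj f s = pull F.obj (incl (hle α W f)) ((x' W _ hf).1 (elt f • α)) := by
    intro α
    refine existsUnique_gluing F (𝔘.box V α) (S.pullback (incl (𝔘.box_le V α)))
      ((topology ρ).pullback_stable _ hS)
      (fun W f hf => pull F.obj (incl (hle α W f)) ((x' W _ hf).1 (elt f • α))) ?_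
    intro W T f hf k
    have h1 := hx' W T _ hf k (elt (k ≫ f) • α)
    have h2 := congrArg (pull F.obj (incl (hle α T (k ≫ f)))) h1
    rw [← pull_comp] at h2
    rw [← pull_comp]
    refine Eq.trans ?_ (h2.trans ?_)
    · exact 𝔘.pull_congr F.obj (x' W _ hf).1 (by simp [mul_smul]) _ _ (by
        change elt k * 1 = 1 * elt k; simp)
    · exact hcongr T _ _ (Category.assoc _ _ _).symm _ _ _ _
  choose s hs hu using hglue
  have huniq : ∀ (α : Fin (q + 1) → A) (a b : F.obj.obj (op (𝔘.box V α))),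
      (∀ (W : QOpen ρ) (f : W ⟶ 𝔘.box V α), S (f ≫ incl (𝔘.box_le V α)) →
        pull F.obj f a = pull F.obj f b) → a = b := by
    intro α a b hab
    obtain ⟨c, -, hc⟩ := existsUnique_gluing F (𝔘.box V α) (S.pullback (incl (𝔘.box_le V α)))
      ((topology ρ).pullback_stable _ hS) (fun W f _ => pull F.obj f a)
      (fun W T f hf k => (pull_comp F.obj k f a).symm)
    rw [hc a fun _ _ _ => rfl, hc b fun W f hf => (hab W f hf).symm]
  have hmem : s ∈ 𝔘.cochains F.obj q V := by
    refine ⟨fun σ α => ?_, fun α hα => ?_⟩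
    · refine huniq α _ _ fun W f hf => ?_
      have e : (f ≫ incl (𝔘.box_le_comp V α σ)) ≫ incl (𝔘.box_le V (α ∘ σ)) =
          f ≫ incl (𝔘.box_le V α) := by ext; simp
      have hf' : S ((f ≫ incl (𝔘.box_le_comp V α σ)) ≫ incl (𝔘.box_le V (α ∘ σ))) := by
        rw [e]; exact hf
      rw [map_zsmul, hs α W f hf, ← map_zsmul, ← (x' W _ hf).2.1, ← pull_comp, ← pull_comp,
        hs (α ∘ σ) W (f ≫ incl (𝔘.box_le_comp V α σ)) hf', hcongr W _ _ e hf' hf]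
      exact 𝔘.pull_congr F.obj (x' W _ hf).1 (by ext; simp) _ _ (mul_one (1 : G)).symm
    · refine huniq α _ _ fun W f hf => ?_
      rw [hs α W f hf, (x' W _ hf).2.2, map_zero, map_zero]
      intro h
      exact hα fun i j hij => h (by simp [hij])
  refine ⟨(⟨s, hmem⟩ : 𝔘.cochains F.obj q V), ?_, ?_⟩
  · intro W f hf
    refine Subtype.ext (funext fun α => ?_)
    change pull F.obj (𝔘.boxHom f α) (s ((elt f)⁻¹ • α)) = (x' W f hf).1 α
    have h1 : S (𝔘.boxHom f α ≫ incl (𝔘.box_le V _)) := by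
      have : 𝔘.boxHom f α ≫ incl (𝔘.box_le V _) = incl (𝔘.box_le W α) ≫ f := by
        ext; simp
      rw [this]; exact S.downward_closed hf _
    rw [hs _ _ _ h1]
    have h2 : ∀ (f' : 𝔘.box W α ⟶ V) (hf' : S f'), f' = incl (𝔘.box_le W α) ≫ f →
        ∀ (β : Fin (q + 1) → A), β = α → ∀ (hb : (𝔘.box W α).carrier ≤
          (𝔘.box (𝔘.box W α) β).carrier),
        pull F.obj (incl hb) ((x' (𝔘.box W α) f' hf').1 β) = (x' W f hf).1 α := by
      rintro _ hf' rfl β rfl hb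
      rw [← hx' W _ f hf (incl (𝔘.box_le W β)) β, ← pull_comp,
        𝔘.pull_congr F.obj (x' W f hf).1 (α := (elt (incl (𝔘.box_le W β)))⁻¹ • β) (α' := β)
          (by simp) (incl hb ≫ 𝔘.boxHom (incl (𝔘.box_le W β)) β) (𝟙 _) (mul_one (1 : G)), pull_id]
    refine h2 _ h1 (by ext; simp) _ (by simp) _
  · intro t ht
    let t' : 𝔘.cochains F.obj q V := t
    refine Subtype.ext (a1 := t') (funext fun α => ?_)
    refine hu α _ fun W f hf => ?_
    have h1 : pull F.obj (𝔘.boxHom (f ≫ incl (𝔘.box_le V α)) (elt f • α))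
        (t'.1 ((elt (f ≫ incl (𝔘.box_le V α)))⁻¹ • elt f • α)) = (x' W _ hf).1 (elt f • α) :=
      congrArg (fun t : 𝔘.cochains F.obj q W => t.1 (elt f • α)) (ht W _ hf)
    rw [← h1, ← pull_comp]
    exact 𝔘.pull_congr F.obj t'.1 (by simp) _ _ (by
      change elt f = 1 * (elt f * 1)
      rw [mul_one, one_mul])

end EquivariantFamily
end Cech

section Complex

variable {G : Type u} [Group G] {X : Scheme.{u}} {ρ : RightAction G X}
  {A : Type u} [MulAction G A]

open QOpen

namespace EquivariantFamily

variable (𝔘 : EquivariantFamily ρ A)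

/-- The Čech differential, the usual alternating sum over the omitted index. -/
def cechDiff (P : (QOpen ρ)ᵒᵖ ⥤ AddCommGrpCat.{u}) (q : ℕ) (V : QOpen ρ) :
    𝔘.cochains P q V →+ 𝔘.cochains P (q + 1) V where
  toFun s := ⟨fun α => ∑ j : Fin (q + 2), (-1 : ℤ) ^ (j : ℕ) •
      pull P (incl (𝔘.box_le_comp V α j.succAbove)) (s.1 (α ∘ j.succAbove)), by
    have hsgn : ∀ (α : Fin (q + 2) → A) (σ : Equiv.Perm (Fin (q + 1)))
        (β : Fin (q + 1) → Fin (q + 2)),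
        pull P (incl (𝔘.box_le_comp V α (β ∘ σ))) (s.1 (α ∘ (β ∘ σ))) =
          ((Equiv.Perm.sign σ : ℤˣ) : ℤ) •
            pull P (incl (𝔘.box_le_comp V α β)) (s.1 (α ∘ β)) := by
      intro α σ β
      rw [← map_zsmul, ← s.2.1, ← pull_comp]
      exact 𝔘.pull_congr P s.1 rfl _ _ (mul_one (1 : G)).symm
    refine ⟨fun σ α => ?_, fun α hα => ?_⟩
    · have h := altSum_comp_perm (B := Fin (q + 2))
        (fun β => pull P (incl (𝔘.box_le_comp V α β)) (s.1 (α ∘ β))) (hsgn α) σ id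
      rw [map_sum]
      refine Eq.trans (Finset.sum_congr rfl fun j _ => ?_) h
      rw [map_zsmul, ← pull_comp]
      congr 1
      exact 𝔘.pull_congr P s.1 rfl _ _ (mul_one (1 : G))
    · exact altSum_eq_zero (B := Fin (q + 2))
        (fun β => pull P (incl (𝔘.box_le_comp V α β)) (s.1 (α ∘ β))) α (hsgn α)
        (fun β β' h => 𝔘.pull_congr P s.1 h _ _
          ((elt_incl _).trans (elt_incl _).symm))
        (fun β h => by rw [s.2.2 _ h, map_zero]) id hα⟩
  map_zero' := Subtype.ext (funext fun α => by
    change ∑ j : Fin (q + 2), (-1 : ℤ) ^ (j : ℕ) •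
      pull P (incl (𝔘.box_le_comp V α j.succAbove)) 0 = 0
    simp)
  map_add' s t := Subtype.ext (funext fun α => by
    change ∑ j : Fin (q + 2), (-1 : ℤ) ^ (j : ℕ) •
        pull P (incl (𝔘.box_le_comp V α j.succAbove))
          (s.1 (α ∘ j.succAbove) + t.1 (α ∘ j.succAbove)) =
      ∑ j : Fin (q + 2), (-1 : ℤ) ^ (j : ℕ) •
        pull P (incl (𝔘.box_le_comp V α j.succAbove)) (s.1 (α ∘ j.succAbove)) +
      ∑ j : Fin (q + 2), (-1 : ℤ) ^ (j : ℕ) •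
        pull P (incl (𝔘.box_le_comp V α j.succAbove)) (t.1 (α ∘ j.succAbove))
    simp only [map_add, smul_add, Finset.sum_add_distrib])

lemma cechDiff_apply (P : (QOpen ρ)ᵒᵖ ⥤ AddCommGrpCat.{u}) (q : ℕ) (V : QOpen ρ)
    (s : 𝔘.cochains P q V) (α : Fin (q + 2) → A) :
    (𝔘.cechDiff P q V s).1 α = ∑ j : Fin (q + 2), (-1 : ℤ) ^ (j : ℕ) •
      pull P (incl (𝔘.box_le_comp V α j.succAbove)) (s.1 (α ∘ j.succAbove)) := rfl

lemma cechDiff_cechDiff (P : (QOpen ρ)ᵒᵖ ⥤ AddCommGrpCat.{u}) (q : ℕ) (V : QOpen ρ)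
    (s : 𝔘.cochains P q V) : 𝔘.cechDiff P (q + 1) V (𝔘.cechDiff P q V s) = 0 := by
  refine Subtype.ext (funext fun α => ?_)
  rw [cechDiff_apply]
  refine Eq.trans (Finset.sum_congr rfl fun j _ => ?_)
    (altSum_altSum fun β => pull P (incl (𝔘.box_le_comp V α β)) (s.1 (α ∘ β)))
  rw [cechDiff_apply, map_sum]
  congr 1
  refine Finset.sum_congr rfl fun i _ => ?_
  rw [map_zsmul, ← pull_comp]
  congr 1
  exact 𝔘.pull_congr P s.1 rfl _ _ (mul_one (1 : G))

lemma cechDiff_naturality (P : (QOpen ρ)ᵒᵖ ⥤ AddCommGrpCat.{u}) (q : ℕ) {V W : QOpen ρ}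
    (f : V ⟶ W) (s : 𝔘.cochains P q W) :
    𝔘.cechDiff P q V (𝔘.cochainsPull P q f s) =
      𝔘.cochainsPull P (q + 1) f (𝔘.cechDiff P q W s) := by
  refine Subtype.ext (funext fun α => ?_)
  change ∑ j : Fin (q + 2), (-1 : ℤ) ^ (j : ℕ) •
      pull P (incl (𝔘.box_le_comp V α j.succAbove)) (pull P (𝔘.boxHom f (α ∘ j.succAbove))
        (s.1 ((elt f)⁻¹ • (α ∘ j.succAbove)))) =
    pull P (𝔘.boxHom f α) (∑ j : Fin (q + 2), (-1 : ℤ) ^ (j : ℕ) •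
      pull P (incl (𝔘.box_le_comp W ((elt f)⁻¹ • α) j.succAbove))
        (s.1 (((elt f)⁻¹ • α) ∘ j.succAbove)))
  rw [map_sum]
  refine Finset.sum_congr rfl fun j _ => ?_
  rw [map_zsmul, ← pull_comp, ← pull_comp]
  congr 1
  exact 𝔘.pull_congr P s.1 rfl _ _ ((one_mul (elt f)).trans (mul_one (elt f)).symm)

/-- The inclusion `P → 𝒞^0`, `s ↦ (s restricted to V ∩ U_a)_a`. -/
def augment (P : (QOpen ρ)ᵒᵖ ⥤ AddCommGrpCat.{u}) (V : QOpen ρ) :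
    P.obj (op V) →+ 𝔘.cochains P 0 V where
  toFun s := ⟨fun α => pull P (incl (𝔘.box_le V α)) s, by
    refine ⟨fun σ α => ?_, fun α hα => ?_⟩
    · have hσ : σ = 1 := Equiv.ext fun i => Subsingleton.elim (α := Fin 1) _ _
      subst hσ
      rw [← pull_comp]
      simp only [Equiv.Perm.sign_one, Units.val_one, one_smul]
      exact congrArg (fun f => pull P f s) (hom_ext (mul_one (1 : G)))
    · exact absurd (fun i j _ => Subsingleton.elim (α := Fin 1) i j) hα⟩
  map_zero' := Subtype.ext (funext fun α => map_zero _)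
  map_add' s t := Subtype.ext (funext fun α => map_add _ _ _)

lemma cechDiff_augment (P : (QOpen ρ)ᵒᵖ ⥤ AddCommGrpCat.{u}) (V : QOpen ρ)
    (s : P.obj (op V)) : 𝔘.cechDiff P 0 V (𝔘.augment P V s) = 0 := by
  refine Subtype.ext (funext fun α => ?_)
  rw [cechDiff_apply]
  have h : ∀ j : Fin 2, pull P (incl (𝔘.box_le_comp V α j.succAbove))
      ((𝔘.augment P V s).1 (α ∘ j.succAbove)) = pull P (incl (𝔘.box_le V α)) s := by
    intro j
    refine (pull_comp P _ _ s).symm.trans ?_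
    exact congrArg (fun f => pull P f s) (hom_ext (mul_one (1 : G)))
  simp [Fin.sum_univ_two, h]

lemma augment_naturality (P : (QOpen ρ)ᵒᵖ ⥤ AddCommGrpCat.{u}) {V W : QOpen ρ}
    (f : V ⟶ W) (s : P.obj (op W)) :
    𝔘.augment P V (pull P f s) = 𝔘.cochainsPull P 0 f (𝔘.augment P W s) := by
  refine Subtype.ext (funext fun α => ?_)
  refine (pull_comp P (incl (𝔘.box_le V α)) f s).symm.trans (Eq.trans ?_
    (pull_comp P (𝔘.boxHom f α) (incl (𝔘.box_le W _)) s))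
  exact congrArg (fun f => pull P f s)
    (hom_ext ((one_mul (elt f)).trans (mul_one (elt f)).symm))

/-- The equivariant sheaf `𝒞^q(𝔘, F) = ∏^alt_{α ∈ A^{q+1}} j_{α*} j_α^* F`. -/
def cechSheaf (F : Sheaf (topology ρ) AddCommGrpCat.{u}) (q : ℕ) :
    Sheaf (topology ρ) AddCommGrpCat.{u} :=
  ⟨𝔘.cechPresheaf F.obj q, 𝔘.cechPresheaf_isSheaf F q⟩

/-- The Čech differential as a morphism of equivariant sheaves. -/
def cechSheafDiff (F : Sheaf (topology ρ) AddCommGrpCat.{u}) (q : ℕ) :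
    𝔘.cechSheaf F q ⟶ 𝔘.cechSheaf F (q + 1) :=
  ⟨{ app := fun V => AddCommGrpCat.ofHom (𝔘.cechDiff F.obj q V.unop)
     naturality := fun _ _ f => AddCommGrpCat.hom_ext (AddMonoidHom.ext fun s =>
      𝔘.cechDiff_naturality F.obj q f.unop s) }⟩

/-- The complex `𝒞^•(𝔘, F)` of equivariant sheaves. -/
def cechComplex (F : Sheaf (topology ρ) AddCommGrpCat.{u}) :
    CochainComplex (Sheaf (topology ρ) AddCommGrpCat.{u}) ℕ :=
  CochainComplex.of (𝔘.cechSheaf F) (𝔘.cechSheafDiff F) fun q => by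
    apply Sheaf.hom_ext
    ext V s
    exact 𝔘.cechDiff_cechDiff F.obj q V.unop s

lemma cechComplex_d (F : Sheaf (topology ρ) AddCommGrpCat.{u}) (q : ℕ) :
    (𝔘.cechComplex F).d q (q + 1) = 𝔘.cechSheafDiff F q := by
  change CochainComplex.of.d (𝔘.cechSheaf F) (𝔘.cechSheafDiff F) q (q + 1) = _
  exact CochainComplex.of_d _ _ q

/-- The augmentation `F → 𝒞^•(𝔘, F)`. -/
noncomputable def cechAugmentation (F : Sheaf (topology ρ) AddCommGrpCat.{u}) :
    (CochainComplex.single₀ (Sheaf (topology ρ) AddCommGrpCat.{u})).obj F ⟶ 𝔘.cechComplex F :=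
  (CochainComplex.fromSingle₀Equiv (𝔘.cechComplex F) F).symm
    ⟨⟨{ app := fun V => AddCommGrpCat.ofHom (𝔘.augment F.obj V.unop)
        naturality := fun _ _ f => AddCommGrpCat.hom_ext (AddMonoidHom.ext fun s =>
          𝔘.augment_naturality F.obj f.unop s) }⟩, by
      rw [show (𝔘.cechComplex F).d 0 1 = 𝔘.cechSheafDiff F 0 from 𝔘.cechComplex_d F 0]
      apply Sheaf.hom_ext
      ext V s
      exact 𝔘.cechDiff_augment F.obj V.unop s⟩

end EquivariantFamily

variable (ρ) in
/-- The open set `X` itself. -/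
def whole : QOpen ρ := ⟨⊤⟩

variable (ρ) in
/-- The endomorphism of `X` given by `g`. -/
def translate (g : G) : whole ρ ⟶ whole ρ := mkHom g le_top

/-- The `G`-invariant global sections. -/
def invariants (P : (QOpen ρ)ᵒᵖ ⥤ AddCommGrpCat.{u}) : AddSubgroup (P.obj (op (whole ρ))) where
  carrier := {s | ∀ g : G, pull P (translate ρ g) s = s}
  zero_mem' g := map_zero _
  add_mem' hs ht g := by rw [map_add, hs g, ht g]
  neg_mem' hs g := by rw [map_neg, hs g]

variable (ρ) in
/-- The functor of equivariant global sections `Γ(X/G, F) = Γ(X, F)^G`. -/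
def equivariantSections : Sheaf (topology ρ) AddCommGrpCat.{u} ⥤ AddCommGrpCat.{u} where
  obj F := AddCommGrpCat.of (invariants F.obj)
  map {F F'} φ := AddCommGrpCat.ofHom
    (((φ.hom.app (op (whole ρ))).hom.comp (invariants F.obj).subtype).codRestrict
      (invariants F'.obj) fun s g => by
        have h := congrArg (fun ψ : F.obj.obj (op (whole ρ)) ⟶ F'.obj.obj (op (whole ρ)) =>
          ψ.hom s.1) (φ.hom.naturality (translate ρ g).op)
        exact h.symm.trans (congrArg (φ.hom.app (op (whole ρ))).hom (s.2 g)))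
  map_id F := rfl
  map_comp φ ψ := rfl

instance : (equivariantSections ρ).Additive where
  map_add := rfl

variable (ρ) in
/-- Equivariant cohomology `H^m(X/G, F)`: the `m`-th right derived functor of `Γ(X/G, -)`. -/
noncomputable def equivariantCohomology (m : ℕ) (F : Sheaf (topology ρ) AddCommGrpCat.{u}) :
    AddCommGrpCat.{u} :=
  ((equivariantSections ρ).rightDerived m).obj F

variable (ρ) in
/-- The structure sheaf `𝒪_X` with its natural equivariant structure. -/
def structureSheaf : Sheaf (topology ρ) AddCommGrpCat.{u} :=
  ⟨structurePresheaf ρ, structurePresheaf_isSheaf⟩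

namespace EquivariantFamily

variable (𝔘 : EquivariantFamily ρ A)

/-- The complex `C^•(𝔘/G, F) = Γ(X/G, 𝒞^•(𝔘, F))`. -/
noncomputable def equivariantCechComplex (F : Sheaf (topology ρ) AddCommGrpCat.{u}) :
    CochainComplex AddCommGrpCat.{u} ℕ :=
  ((equivariantSections ρ).mapHomologicalComplex (ComplexShape.up ℕ)).obj (𝔘.cechComplex F)

/-- The component `z_α ∈ F(X ∩ U_α)` of an equivariant cochain `z ∈ C^q(𝔘/G, F)`. -/
def component (F : Sheaf (topology ρ) AddCommGrpCat.{u}) {q : ℕ}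
    (z : (𝔘.equivariantCechComplex F).X q) (α : Fin (q + 1) → A) :
    F.obj.obj (op (𝔘.box (whole ρ) α)) :=
  (show 𝔘.cochains F.obj q (whole ρ) from
    (show invariants (𝔘.cechPresheaf F.obj q) from z).1).1 α

/-- `c ∈ H^m(X/G, F)` is the class of the cochain `z ∈ C^m(𝔘/G, F)`: `z` is a cocycle `ζ`, and for some
injective resolution `F → I^•` and some morphism of complexes `φ : 𝒞^•(𝔘, F) → I^•` under `F`, the
map `H^m(C^•(𝔘/G, F)) → H^m(Γ(X/G, I^•)) = H^m(X/G, F)` induced by `φ` sends the class of `ζ` to `c`. -/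
def IsClassOf (F : Sheaf (topology ρ) AddCommGrpCat.{u}) {m : ℕ}
    (z : (𝔘.equivariantCechComplex F).X m) (c : equivariantCohomology ρ m F) : Prop :=
  ∃ (ζ : (𝔘.equivariantCechComplex F).cycles m)
    (I : InjectiveResolution F) (φ : 𝔘.cechComplex F ⟶ I.cocomplex),
    ((𝔘.equivariantCechComplex F).iCycles m).hom ζ = z ∧
    𝔘.cechAugmentation F ≫ φ = I.ι ∧
    (I.isoRightDerivedObj (equivariantSections ρ) m).hom.hom c =
      (HomologicalComplex.homologyMap
        (((equivariantSections ρ).mapHomologicalComplex (ComplexShape.up ℕ)).map φ) m).hom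
        (((𝔘.equivariantCechComplex F).homologyπ m).hom ζ)

end EquivariantFamily
end Complex

open NumberField Module

section Arithmetic

variable {F : Type u} [Field F]

/-- Total positivity: positivity under all real embeddings. -/
def IsTotPos (x : F) : Prop := ∀ φ : F →+* ℝ, 0 < φ x

lemma IsTotPos.mul {x y : F} (hx : IsTotPos x) (hy : IsTotPos y) : IsTotPos (x * y) :=
  fun φ => by rw [map_mul]; exact mul_pos (hx φ) (hy φ)

variable (F) in
/-- The group `Δ` of totally positive units. -/
def totPosUnits : Subgroup (𝓞 F)ˣ where
  carrier := {ε | IsTotPos ((ε : 𝓞 F) : F)}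
  one_mem' φ := by simp
  mul_mem' ha hb := by simpa using ha.mul hb
  inv_mem' := by
    intro ε h φ
    have h1 : φ ((ε : 𝓞 F) : F) * φ (((ε⁻¹ : (𝓞 F)ˣ) : 𝓞 F) : F) = 1 := by
      rw [← map_mul, ← map_mul (algebraMap (𝓞 F) F), Units.mul_inv, map_one, map_one]
    exact pos_of_mul_pos_right (h1 ▸ one_pos) (h φ).le

variable (F) in
/-- The set `A` of primitive totally positive integers: the totally positive `α` such that `α / N` is not
a totally positive integer for any integer `N > 1`. -/
def primitives : Set (𝓞 F) :=
  {α : 𝓞 F | IsTotPos (α : F) ∧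
    ∀ N : ℕ, 1 < N → ¬ ∃ β : 𝓞 F, IsTotPos (β : F) ∧ (β : F) = (α : F) / (N : F)}

/-- `Δ` acts on `A` by multiplication. -/
instance : MulAction (totPosUnits F) (primitives F) where
  smul ε α := ⟨((ε : (𝓞 F)ˣ) : 𝓞 F) * α.1, by
    refine ⟨by simpa using ε.2.mul α.2.1, ?_⟩
    rintro N hN ⟨β, hβ, h⟩
    refine α.2.2 N hN ⟨(((ε⁻¹ : totPosUnits F) : (𝓞 F)ˣ) : 𝓞 F) * β, ?_, ?_⟩
    · simpa using (ε⁻¹).2.mul hβ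
    · have h1 : (((ε : (𝓞 F)ˣ)⁻¹ : (𝓞 F)ˣ) : 𝓞 F) * ((ε : (𝓞 F)ˣ) : 𝓞 F) = 1 :=
        Units.inv_mul _
      have h2 := congrArg (algebraMap (𝓞 F) F) h1
      rw [map_mul, map_one] at h2
      change algebraMap (𝓞 F) F ((((ε : (𝓞 F)ˣ)⁻¹ : (𝓞 F)ˣ) : 𝓞 F) * β) = _
      have h' : algebraMap (𝓞 F) F β =
          algebraMap (𝓞 F) F (((ε : (𝓞 F)ˣ) : 𝓞 F) * α.1) / (N : F) := h
      rw [map_mul (algebraMap (𝓞 F) F), h', map_mul (algebraMap (𝓞 F) F)]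
      rw [mul_div_assoc, ← mul_assoc, h2, one_mul]⟩
  one_smul α := Subtype.ext (one_mul α.1)
  mul_smul ε δ α := Subtype.ext (mul_assoc ((ε : (𝓞 F)ˣ) : 𝓞 F) ((δ : (𝓞 F)ˣ) : 𝓞 F) α.1)

lemma primitives_smul_val (ε : totPosUnits F) (α : primitives F) :
    (ε • α).1 = ((ε : (𝓞 F)ˣ) : 𝓞 F) * α.1 := rfl

variable (F) in
/-- The group ring `ℤ[t^α | α ∈ 𝓞 F]`, with `t^α t^β = t^{α + β}`. -/
abbrev CoordRing : Type u := AddMonoidAlgebra ℤ (𝓞 F)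

/-- The element `t^α`. -/
noncomputable def monom (α : 𝓞 F) : CoordRing F := AddMonoidAlgebra.single α 1

variable (F) in
/-- The torus `𝕋 = Hom(𝓞 F, 𝔾_m) = Spec ℤ[t^α | α ∈ 𝓞 F]`. -/
noncomputable abbrev torus : Scheme.{u} := Spec (CommRingCat.of (CoordRing F))

/-- The automorphism `t^α ↦ t^{εα}` of the coordinate ring. -/
noncomputable def actRing (ε : totPosUnits F) : CoordRing F →+* CoordRing F :=
  AddMonoidAlgebra.mapDomainRingHom ℤ (AddMonoidHom.mulLeft ((ε : (𝓞 F)ˣ) : 𝓞 F))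

lemma actRing_monom (ε : totPosUnits F) (α : 𝓞 F) :
    actRing ε (monom α) = monom (((ε : (𝓞 F)ˣ) : 𝓞 F) * α) := by
  simp [actRing, monom]

lemma ringHom_ext_monom {R : Type*} [CommRing R] {f g : CoordRing F →+* R}
    (h : ∀ α, f (monom α) = g (monom α)) : f = g :=
  AddMonoidAlgebra.ringHom_ext' (Subsingleton.elim _ _) (MonoidHom.ext fun α => h α.toAdd)

lemma actRing_one : actRing (1 : totPosUnits F) = RingHom.id _ :=
  ringHom_ext_monom fun α => by simp [actRing_monom]

lemma actRing_mul (ε δ : totPosUnits F) : actRing (ε * δ) = (actRing ε).comp (actRing δ) :=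
  ringHom_ext_monom fun α => by simp [actRing_monom, mul_assoc]

variable (F) in
/-- The right action of `Δ` on `𝕋`, with `[ε]` given by `t^α ↦ t^{εα}`. -/
noncomputable def torusAction : RightAction (totPosUnits F) (torus F) where
  act ε := Spec.map (CommRingCat.ofHom (actRing ε))
  act_one := by rw [actRing_one]; exact Spec.map_id _
  act_mul ε δ := by
    rw [← Spec.map_comp, actRing_mul]; rfl

variable (F) in
/-- The homomorphism `t^α ↦ 1` to `ℤ`, which defines the identity section `1` of `𝕋`. -/
noncomputable def counit : CoordRing F →+* ℤ :=
  (AddMonoidAlgebra.lift ℤ ℤ (𝓞 F) (1 : Multiplicative (𝓞 F) →* ℤ)).toRingHom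

lemma counit_monom (α : 𝓞 F) : counit F (monom α) = 1 := by
  simp [counit, monom]

lemma counit_comp_actRing (ε : totPosUnits F) : (counit F).comp (actRing ε) = counit F :=
  ringHom_ext_monom fun α => by simp [actRing_monom, counit_monom]

variable (F) in
/-- The open subset `U = 𝕋 ∖ {1}`, the complement of the image of the identity section. -/
noncomputable def puncturedTorus : (torus F).Opens :=
  ⟨(Set.range (PrimeSpectrum.comap (counit F)))ᶜ, by
    rw [isOpen_compl_iff]
    exact PrimeSpectrum.isClosed_range_comap_of_surjective _ _ fun n => ⟨n, by simp⟩⟩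

lemma puncturedTorus_le_preimage (ε : totPosUnits F) :
    puncturedTorus F ≤ (torusAction F).act ε ⁻¹ᵁ puncturedTorus F := by
  rintro x hx ⟨p, hp⟩
  refine hx ⟨p, ?_⟩
  have h1 := act_inv_act (torusAction F) ε x
  rw [← h1]
  change _ = PrimeSpectrum.comap (actRing ε⁻¹) (((torusAction F).act ε) x)
  rw [← (show _ = ((torusAction F).act ε) x from hp), ← PrimeSpectrum.comap_comp_apply,
    counit_comp_actRing]

variable (F) in
/-- The action of `Δ` on the open subscheme `U`. -/
noncomputable def puncturedAction :
    RightAction (totPosUnits F) (puncturedTorus F).toScheme where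
  act ε := ((torusAction F).act ε).resLE _ _ (puncturedTorus_le_preimage ε)
  act_one := by
    rw [← cancel_mono (puncturedTorus F).ι, Scheme.Hom.resLE_comp_ι, (torusAction F).act_one,
      Category.comp_id, Category.id_comp]
  act_mul ε δ := by
    rw [← cancel_mono (puncturedTorus F).ι]
    simp [Scheme.Hom.resLE_comp_ι, (torusAction F).act_mul]

/-- The open subset `U_α = 𝕋 ∖ {t^α = 1}`. -/
noncomputable def torusOpen (α : 𝓞 F) : (torus F).Opens :=
  PrimeSpectrum.basicOpen (1 - monom α)

lemma torusOpen_mul (ε : totPosUnits F) (α : 𝓞 F) :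
    torusOpen (((ε : (𝓞 F)ˣ) : 𝓞 F) * α) = (torusAction F).act ε ⁻¹ᵁ torusOpen α := by
  have h := PrimeSpectrum.comap_basicOpen (actRing ε) (1 - monom α)
  rw [map_sub, map_one, actRing_monom] at h
  exact h.symm

variable (F) in
/-- The family `𝔘 = (U_α)_{α ∈ A}` of open subsets of `U`. -/
noncomputable def standardCover : EquivariantFamily (puncturedAction F) (primitives F) where
  opens α := (puncturedTorus F).ι ⁻¹ᵁ torusOpen α.1
  opens_smul ε α := by
    rw [primitives_smul_val, torusOpen_mul, ← Scheme.Hom.comp_preimage,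
      ← Scheme.Hom.comp_preimage]
    exact congrArg (fun f : (puncturedTorus F).toScheme ⟶ torus F => f ⁻¹ᵁ torusOpen α.1)
      (Scheme.Hom.resLE_comp_ι ..).symm

variable {n : ℕ} (τ : Fin (n + 1) ≃ (F →+* ℝ))

/-- The vector `(x^{τ_1}, …, x^{τ_g})`, where `g = n + 1`. -/
def embed (x : F) : Fin (n + 1) → ℝ := fun i => τ i x

/-- The parallelepiped `P_α = {x_1 α_1 + ⋯ + x_g α_g | 0 ≤ x_i < 1}` in `ℝ^I`. -/
def parallelepiped (α : Fin (n + 1) → primitives F) : Set (Fin (n + 1) → ℝ) :=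
  {u | ∃ x : Fin (n + 1) → ℝ, (∀ i, 0 ≤ x i ∧ x i < 1) ∧
    u = ∑ i, x i • embed τ ((α i).1 : F)}

/-- The set of all `u` with positive coordinates such that, for some `δ > 0`, the points
`(u_1, …, u_{g-1}, u_g - δ')` with `0 < δ' < δ` all lie in `R`. -/
def upperClosure (R : Set (Fin (n + 1) → ℝ)) : Set (Fin (n + 1) → ℝ) :=
  {u | (∀ i, 0 < u i) ∧ ∃ δ > 0, ∀ δ', 0 < δ' → δ' < δ → u - Pi.single (Fin.last n) δ' ∈ R}

/-- The totally positive integers whose vector lies in the upper closure of `P_α`. -/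
def latticePoints (α : Fin (n + 1) → primitives F) : Set (𝓞 F) :=
  {β | embed τ (β : F) ∈ upperClosure (parallelepiped τ α)}

lemma finite_latticePoints [NumberField F] [IsTotallyReal F]
    (α : Fin (n + 1) → primitives F) : (latticePoints τ α).Finite := by
  have key : ∀ β ∈ latticePoints τ α, ∀ i, |τ i (β : F)| ≤ ∑ k, ∑ j, τ k ((α j).1 : F) + 1 := by
    rintro β ⟨hpos, δ, hδ, h⟩ i
    obtain ⟨x, hx, hxu⟩ := h (min (δ / 2) 1) (by positivity)
      ((min_le_left _ _).trans_lt (by linarith))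
    have hi := congrFun hxu i
    simp only [Pi.sub_apply, Finset.sum_apply, Pi.smul_apply, smul_eq_mul, embed] at hi
    rw [abs_of_pos (show 0 < τ i (β : F) from hpos i)]
    have h1 : (Pi.single (Fin.last n) (min (δ / 2) 1) : Fin (n + 1) → ℝ) i ≤ 1 := by
      rw [Pi.single_apply]; split_ifs
      · exact min_le_right _ _
      · exact zero_le_one
    have h2 : ∑ j, x j * τ i ((α j).1 : F) ≤ ∑ j, τ i ((α j).1 : F) :=
      Finset.sum_le_sum fun j _ =>
        mul_le_of_le_one_left ((α j).2.1 (τ i)).le (hx j).2.le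
    have h3 : ∑ j, τ i ((α j).1 : F) ≤ ∑ k, ∑ j, τ k ((α j).1 : F) :=
      Finset.single_le_sum (f := fun k => ∑ j, τ k ((α j).1 : F))
        (fun k _ => Finset.sum_nonneg fun j _ => ((α j).2.1 (τ k)).le) (Finset.mem_univ i)
    linarith
  have hfin := Embeddings.finite_of_norm_le F ℂ (∑ k, ∑ j, τ k ((α j).1 : F) + 1)
  refine (hfin.preimage (f := fun β : 𝓞 F => (β : F))
    (RingOfIntegers.coe_injective.injOn)).subset fun β hβ => ⟨RingOfIntegers.isIntegral_coe β, ?_⟩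
  intro φ
  have hφ : ComplexEmbedding.IsReal φ := by
    have h := IsTotallyReal.isReal (InfinitePlace.mk φ)
    exact InfinitePlace.isReal_mk_iff.1 h
  have h := key β hβ (τ.symm hφ.embedding)
  rw [Equiv.apply_symm_apply] at h
  rw [← hφ.coe_embedding_apply, Complex.norm_real]
  exact h

/-- The sign of `det (α_j^{τ_i})`. -/
noncomputable def sgn (α : Fin (n + 1) → primitives F) : ℤ :=
  (SignType.sign (Matrix.det (Matrix.of fun i j => τ i ((α j).1 : F))) : SignType)

/-- The open subset `U_{α_1} ∩ ⋯ ∩ U_{α_g}` of `𝕋`. -/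
noncomputable def torusInter (α : Fin (n + 1) → primitives F) : (torus F).Opens :=
  ⨅ i, torusOpen (α i).1

/-- An element of the coordinate ring as a function on the open subset `V` of `𝕋`. -/
noncomputable def toSections (V : (torus F).Opens) : CoordRing F →+* Γ(torus F, V) :=
  ((Scheme.ΓSpecIso (CommRingCat.of (CoordRing F))).inv ≫
    (torus F).presheaf.map (homOfLE le_top).op).hom

lemma isUnit_denominator (α : Fin (n + 1) → primitives F) :
    IsUnit (toSections (torusInter α) (∏ i, (1 - monom (α i).1))) := by
  rw [map_prod, IsUnit.prod_univ_iff]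
  intro i
  have hle : torusInter α ≤
      (torus F).basicOpen ((Scheme.ΓSpecIso (CommRingCat.of (CoordRing F))).inv
        (1 - monom (α i).1)) := by
    rw [basicOpen_eq_of_affine]
    exact iInf_le _ i
  have h := ((torus F).toRingedSpace.isUnit_res_basicOpen
    ((Scheme.ΓSpecIso (CommRingCat.of (CoordRing F))).inv (1 - monom (α i).1))).map
    ((torus F).presheaf.map (homOfLE hle).op).hom
  convert! h using 1

/-- The rational function `(∑ t^β) / ((1 - t^{α_1}) ⋯ (1 - t^{α_g}))` in `Γ(U_α, 𝒪_𝕋)`, where `β` runs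
through the integers in the upper closure of `P_α`. -/
noncomputable def shintaniFunction [NumberField F] [IsTotallyReal F]
    (α : Fin (n + 1) → primitives F) : Γ(torus F, torusInter α) :=
  toSections (torusInter α) (∑ β ∈ (finite_latticePoints τ α).toFinset, monom β) *
    ((isUnit_denominator α).unit⁻¹ : (Γ(torus F, torusInter α))ˣ)

end Arithmetic

open NumberField


lemma box_le_torusInter {F : Type u} [Field F] {n : ℕ} (α : Fin (n + 1) → primitives F) :
    ((standardCover F).box (whole (puncturedAction F)) α).carrier ≤
      (puncturedTorus F).ι ⁻¹ᵁ torusInter α := by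
  intro x hx
  have h := ((standardCover F).mem_inter α x).1 hx.2
  change (puncturedTorus F).ι x ∈ torusInter α
  rw [← SetLike.mem_coe, torusInter, TopologicalSpace.Opens.coe_iInf]
  exact Set.mem_iInter.2 h

section Cocycle

variable {F : Type u} [Field F] [NumberField F] [IsTotallyReal F] {n : ℕ}

/-- The function `sgn(α) 𝒢_{σ_α}` in `Γ(U_α, 𝒪_𝕋)`. -/
noncomputable def signedShintani (τ : Fin (n + 1) ≃ (F →+* ℝ)) (α : Fin (n + 1) → primitives F) :
    Γ(torus F, torusInter α) :=
  sgn τ α • shintaniFunction τ α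

/-- The function `sgn(α) 𝒢_{σ_α}` as a section of `𝒪_U` over the open subset `U_α` of `U`. -/
noncomputable def shintaniComponent (τ : Fin (n + 1) ≃ (F →+* ℝ))
    (α : Fin (n + 1) → primitives F) :
    (structureSheaf (puncturedAction F)).obj.obj
      (op ((standardCover F).box (whole (puncturedAction F)) α)) :=
  ((puncturedTorus F).ι.appLE (torusInter α)
    ((standardCover F).box (whole (puncturedAction F)) α).carrier
    (box_le_torusInter α)).hom (signedShintani τ α)

end Cocycle

end Shintani

/-!
The exponents `β` with `t^β = 1` at a given point of `𝕋` form a group; if it contains all primitive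
elements it is `𝒪_F` and the point lies on the identity section, so the `U_α` cover `U`. Over
`V ∩ U_a` the Čech complex is contracted by inserting the index `a`, so it is a resolution. A
morphism under the sheaf from a resolution to an injective resolution exists and is unique up to
homotopy; hence a Čech cocycle has exactly one class.

After multiplication by `∏ (1 - t^{α_j})`, the cocycle condition says that the indicator functions
of the `g + 1` cones spanned by `g` of the vectors `α_0, …, α_g` cancel when taken with signs. The
solutions `x` of `∑ x_j α_j = v` form a line whose direction has the signed minors as coordinates,
and the signs count how often this line enters and leaves the closed orthant; it does both, because
the `α_j` are positive and the direction therefore has coordinates of both signs. The line is in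
general position for `v = β - δ e_g` with `δ > 0` small, since the coordinates of `e_g` with respect
to a basis from `F` are conjugates of the elements of the dual basis and therefore nonzero.
-/

namespace Shintani

open CategoryTheory Limits AlgebraicGeometry Opposite QOpen NumberField Module Topology Filter

universe w' w v' v u

section Resolution

variable {C : Type w} [Category.{w'} C] [Abelian C] {Z : C} {K J : CochainComplex C ℕ}
  {a : (CochainComplex.single₀ C).obj Z ⟶ K}

lemma single₀_hom_comp_d (f : (CochainComplex.single₀ C).obj Z ⟶ J) : f.f 0 ≫ J.d 0 1 = 0 := by
  rw [f.comm 0 1, HomologicalComplex.single_obj_d, zero_comp]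

/-- An augmented cochain complex `0 → Z → K⁰ → K¹ → ⋯` that is exact. -/
structure IsResolution (a : (CochainComplex.single₀ C).obj Z ⟶ K) : Prop where
  mono : Mono (a.f 0)
  exact₀ : (ShortComplex.mk (a.f 0) (K.d 0 1) (single₀_hom_comp_d a)).Exact
  exact_succ : ∀ n, (ShortComplex.mk _ _ (K.d_comp_d n (n + 1) (n + 2))).Exact

namespace IsResolution

variable [∀ n, Injective (J.X n)]

lemma exists_comp_eq (h : IsResolution a) (f : (CochainComplex.single₀ C).obj Z ⟶ J) :
    ∃ φ : K ⟶ J, a ≫ φ = f := by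
  have := h.mono
  let φ₀ : K.X 0 ⟶ J.X 0 := Injective.factorThru (f.f 0) (a.f 0)
  have hφ₀ : a.f 0 ≫ φ₀ = f.f 0 := Injective.comp_factorThru _ _
  have w₀ : a.f 0 ≫ φ₀ ≫ J.d 0 1 = 0 := by rw [reassoc_of% hφ₀, single₀_hom_comp_d]
  let φ₁ : K.X 1 ⟶ J.X 1 := h.exact₀.descToInjective (φ₀ ≫ J.d 0 1) w₀
  have hφ₁ : K.d 0 1 ≫ φ₁ = φ₀ ≫ J.d 0 1 := h.exact₀.comp_descToInjective _ _
  have extend (n : ℕ) (g : K.X n ⟶ J.X n) (g' : K.X (n + 1) ⟶ J.X (n + 1))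
      (w : g ≫ J.d n (n + 1) = K.d n (n + 1) ≫ g') :
      ∃ g'' : K.X (n + 2) ⟶ J.X (n + 2),
        g' ≫ J.d (n + 1) (n + 2) = K.d (n + 1) (n + 2) ≫ g'' := by
    have w' : K.d n (n + 1) ≫ g' ≫ J.d (n + 1) (n + 2) = 0 := by
      rw [← reassoc_of% w, HomologicalComplex.d_comp_d, comp_zero]
    exact ⟨(h.exact_succ n).descToInjective _ w', ((h.exact_succ n).comp_descToInjective _ _).symm⟩
  refine ⟨CochainComplex.mkHom _ _ φ₀ φ₁ hφ₁.symm fun n p =>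
    ⟨_, (extend n p.1 p.2.1 p.2.2).choose_spec⟩, ?_⟩
  apply HomologicalComplex.from_single_hom_ext
  simpa using hφ₀

lemma nonempty_homotopy_zero (h : IsResolution a) {φ : K ⟶ J} (hφ : a ≫ φ = 0) :
    Nonempty (Homotopy φ 0) := by
  let s₀ : K.X 1 ⟶ J.X 0 :=
    h.exact₀.descToInjective (φ.f 0) (HomologicalComplex.congr_hom hφ 0)
  have hs₀ : K.d 0 1 ≫ s₀ = φ.f 0 := h.exact₀.comp_descToInjective _ _
  have w₁ : K.d 0 1 ≫ (φ.f 1 - s₀ ≫ J.d 0 1) = 0 := by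
    rw [Preadditive.comp_sub, reassoc_of% hs₀, HomologicalComplex.Hom.comm, sub_self]
  let s₁ : K.X 2 ⟶ J.X 1 := (h.exact_succ 0).descToInjective _ w₁
  have hs₁ : K.d 1 2 ≫ s₁ = φ.f 1 - s₀ ≫ J.d 0 1 := (h.exact_succ 0).comp_descToInjective _ _
  have extend (n : ℕ) (g : K.X (n + 1) ⟶ J.X n) (g' : K.X (n + 2) ⟶ J.X (n + 1))
      (w : φ.f (n + 1) = g ≫ J.d n (n + 1) + K.d (n + 1) (n + 2) ≫ g') :
      ∃ g'' : K.X (n + 3) ⟶ J.X (n + 2),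
        φ.f (n + 2) = g' ≫ J.d (n + 1) (n + 2) + K.d (n + 2) (n + 3) ≫ g'' := by
    have w' : K.d (n + 1) (n + 2) ≫ (φ.f (n + 2) - g' ≫ J.d (n + 1) (n + 2)) = 0 := by
      rw [Preadditive.comp_sub, ← HomologicalComplex.Hom.comm, w, Preadditive.add_comp,
        Category.assoc, Category.assoc, HomologicalComplex.d_comp_d, comp_zero, zero_add, sub_self]
    exact ⟨(h.exact_succ (n + 1)).descToInjective _ w',
      (add_eq_of_eq_sub' ((h.exact_succ (n + 1)).comp_descToInjective _ w')).symm⟩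
  exact ⟨Homotopy.mkCoinductive _ s₀ hs₀.symm s₁ (by rw [hs₁]; abel) fun n p =>
    ⟨_, (extend n p.1 p.2.1 p.2.2).choose_spec⟩⟩

lemma nonempty_homotopy (h : IsResolution a) {φ ψ : K ⟶ J} (hφψ : a ≫ φ = a ≫ ψ) :
    Nonempty (Homotopy φ ψ) :=
  (h.nonempty_homotopy_zero (by rw [Preadditive.comp_sub, hφψ, sub_self])).map
    Homotopy.equivSubZero.symm

variable [HasInjectiveResolutions C] {D : Type v} [Category.{v'} D] [Abelian D]
  (T : C ⥤ D) [T.Additive]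

/-- The canonical map `Hᵐ(T K) → (Rᵐ T) Z` for a resolution `K` of `Z`. -/
noncomputable def toRightDerived (h : IsResolution a) (m : ℕ) :
    (T.mapHomologicalComplex (ComplexShape.up ℕ) ⋙ HomologicalComplex.homologyFunctor D _ m).obj K ⟶
      (T.rightDerived m).obj Z :=
  (T.mapHomologicalComplex (ComplexShape.up ℕ) ⋙ HomologicalComplex.homologyFunctor D _ m).map
    (h.exists_comp_eq (injectiveResolution Z).ι).choose ≫
    ((injectiveResolution Z).isoRightDerivedObj T m).inv

lemma toRightDerived_comp_isoRightDerivedObj_hom (h : IsResolution a) (I : InjectiveResolution Z)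
    {φ : K ⟶ I.cocomplex} (hφ : a ≫ φ = I.ι) (m : ℕ) :
    h.toRightDerived T m ≫ (I.isoRightDerivedObj T m).hom =
      (T.mapHomologicalComplex (ComplexShape.up ℕ) ⋙
        HomologicalComplex.homologyFunctor D _ m).map φ := by
  let I₀ := injectiveResolution Z
  let φ₀ : K ⟶ I₀.cocomplex := (h.exists_comp_eq I₀.ι).choose
  have hφ₀ : a ≫ φ₀ = I₀.ι := (h.exists_comp_eq I₀.ι).choose_spec
  let e : I₀.cocomplex ⟶ I.cocomplex := (InjectiveResolution.homotopyEquiv I₀ I).hom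
  have he : I₀.ι ≫ e = I.ι := InjectiveResolution.homotopyEquiv_hom_ι I₀ I
  obtain ⟨s⟩ := h.nonempty_homotopy (φ := φ₀ ≫ e) (ψ := φ) (by rw [hφ, reassoc_of% hφ₀, he])
  have homotopic := (T.mapHomotopy s).homologyMap_eq m
  have natural := InjectiveResolution.isoRightDerivedObj_inv_naturality (𝟙 Z) I₀ I e
    (by rw [← HomologicalComplex.comp_f, he]; exact (Category.id_comp _).symm) T m
  rw [CategoryTheory.Functor.map_id, Category.comp_id] at natural
  rw [← Iso.eq_comp_inv, toRightDerived, natural, ← Functor.map_comp_assoc]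
  exact congrArg (· ≫ _) homotopic

end IsResolution

end Resolution

section Tuples

variable {A : Type*} {q : ℕ}

lemma exists_perm_cons_comp (σ : Equiv.Perm (Fin q)) :
    ∃ σ' : Equiv.Perm (Fin (q + 1)), Equiv.Perm.sign σ' = Equiv.Perm.sign σ ∧
      ∀ (a : A) (α : Fin q → A),
        (Fin.cons a α : Fin (q + 1) → A) ∘ σ' = Fin.cons a (α ∘ σ) := by
  refine ⟨Equiv.Perm.decomposeFin.symm (0, σ), by simp, fun a α => funext fun k => ?_⟩
  cases k using Fin.cases <;> simp

lemma cons_comp_succAbove_succ (a : A) (α : Fin (q + 1) → A) (j : Fin (q + 1)) :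
    (Fin.cons a α : Fin (q + 2) → A) ∘ j.succ.succAbove = Fin.cons a (α ∘ j.succAbove) := by
  funext k
  cases k using Fin.cases <;> simp

end Tuples

section CechResolution

variable {G : Type u} [Group G] {X : Scheme.{u}} {ρ : RightAction G X}

lemma sheaf_exact_of_locally_exact (S : ShortComplex (Sheaf (topology ρ) AddCommGrpCat.{u}))
    (h : ∀ (V : QOpen ρ) (s : S.X₂.obj.obj (op V)), (S.g.hom.app (op V)).hom s = 0 →
      ∀ x ∈ V.carrier, ∃ (W : QOpen ρ) (i : W ⟶ V), (∃ y ∈ W.carrier, (ρ.act (elt i)) y = x) ∧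
        ∃ t : S.X₁.obj.obj (op W), (S.f.hom.app (op W)).hom t = pull S.X₂.obj i s) :
    S.Exact := by
  rw [S.exact_iff_epi_kernel_lift, ← Sheaf.isLocallySurjective_iff_epi']
  have ι_injective (V : QOpen ρ) :
      Function.Injective ((kernel.ι S.g).hom.app (op V)).hom := by
    have : Mono ((sheafToPresheaf _ _).map (kernel.ι S.g)) := inferInstance
    exact (AddCommGrpCat.mono_iff_injective (((sheafToPresheaf _ _).map (kernel.ι S.g)).app
      (op V))).1 inferInstance
  refine ⟨fun {V} s x hx => ?_⟩
  have hs : (S.g.hom.app (op V)).hom (((kernel.ι S.g).hom.app (op V)).hom s) = 0 :=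
    congrArg (fun k : kernel S.g ⟶ S.X₃ => (k.hom.app (op V)).hom s) (kernel.condition S.g)
  obtain ⟨W, i, hy, t, ht⟩ := h V _ hs x hx
  have ι_lift : ((kernel.ι S.g).hom.app (op W)).hom
      (((kernel.lift S.g S.f S.zero).hom.app (op W)).hom t) = (S.f.hom.app (op W)).hom t :=
    congrArg (fun k : S.X₁ ⟶ S.X₂ => (k.hom.app (op W)).hom t) (kernel.lift_ι S.g S.f S.zero)
  have ι_natural := congrArg (fun k => k.hom s) ((kernel.ι S.g).hom.naturality i.op)
  exact ⟨W, i, ⟨t, ι_injective W (ι_lift.trans (ht.trans ι_natural.symm))⟩, hy⟩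

variable {A : Type u} [MulAction G A]

namespace EquivariantFamily

variable (𝔘 : EquivariantFamily ρ A) (P : (QOpen ρ)ᵒᵖ ⥤ AddCommGrpCat.{u})

lemma box_le_cons (V : QOpen ρ) (a : A) {k : ℕ} (α : Fin k → A) :
    (𝔘.box (𝔘.box V fun _ : Fin 1 => a) α).carrier ≤ (𝔘.box V (Fin.cons a α)).carrier := by
  intro x hx
  refine ⟨hx.1.1, (𝔘.mem_inter _ _).2 fun i => ?_⟩
  cases i using Fin.cases with
  | zero => exact (𝔘.mem_inter _ _).1 hx.1.2 0
  | succ i => exact (𝔘.mem_inter _ _).1 hx.2 i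

/-- The contracting homotopy `s ↦ (s_{a, α})_α` of the Čech complex over `V ∩ U_a`. -/
def contract (q : ℕ) (V : QOpen ρ) (a : A) (s : 𝔘.cochains P (q + 1) V) :
    𝔘.cochains P q (𝔘.box V fun _ : Fin 1 => a) :=
  ⟨fun α => pull P (incl (𝔘.box_le_cons V a α)) (s.1 (Fin.cons a α)), by
    refine ⟨fun σ α => ?_, fun α hα => ?_⟩
    · obtain ⟨σ', hsign, hcons⟩ := exists_perm_cons_comp (A := A) σ
      rw [← hsign, ← map_zsmul, ← s.2.1 σ' (Fin.cons a α), ← pull_comp, ← pull_comp]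
      exact 𝔘.pull_congr P s.1 (hcons a α).symm _ _ (by simp)
    · change pull P _ (s.1 (Fin.cons a α)) = 0
      rw [s.2.2 _ fun h => hα fun i j hij => ?_, map_zero]
      exact Fin.succ_injective _ (h (by simpa using hij))⟩

lemma sum_pull_cons_of_cechDiff_eq_zero {q : ℕ} {V : QOpen ρ} (a : A) {s : 𝔘.cochains P q V}
    (hs : 𝔘.cechDiff P q V s = 0) (α : Fin (q + 1) → A) :
    ∑ j : Fin (q + 1), (-1 : ℤ) ^ (j : ℕ) •
      pull P (incl (𝔘.box_le_comp (𝔘.box V fun _ : Fin 1 => a) α j.succAbove))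
        (pull P (incl (𝔘.box_le_cons V a _)) (s.1 (Fin.cons a (α ∘ j.succAbove)))) =
      (𝔘.cochainsPull P q (incl (𝔘.box_le V fun _ : Fin 1 => a)) s).1 α := by
  have h : pull P (incl (𝔘.box_le_cons V a α)) ((𝔘.cechDiff P q V s).1 (Fin.cons a α)) = 0 := by
    rw [hs]
    exact map_zero _
  rw [cechDiff_apply, map_sum, Fin.sum_univ_succ] at h
  simp only [map_neg, map_zsmul, ← pull_comp, Fin.val_zero, pow_zero, one_smul, Fin.val_succ,
    pow_succ, mul_neg, mul_one, neg_smul, Finset.sum_neg_distrib] at h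
  refine Eq.trans (Finset.sum_congr rfl fun j _ => ?_) ((add_neg_eq_zero.1 h).symm.trans ?_)
  · rw [← pull_comp]
    exact congrArg _ (𝔘.pull_congr P s.1 (cons_comp_succAbove_succ a α j).symm _ _ (by simp))
  · exact 𝔘.pull_congr P s.1 (by simp) _ _ (mul_one (1 : G))

lemma cechDiff_contract {q : ℕ} {V : QOpen ρ} (a : A) {s : 𝔘.cochains P (q + 1) V}
    (hs : 𝔘.cechDiff P (q + 1) V s = 0) :
    𝔘.cechDiff P q _ (𝔘.contract P q V a s) =
      𝔘.cochainsPull P (q + 1) (incl (𝔘.box_le V fun _ : Fin 1 => a)) s :=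
  Subtype.ext (funext fun α => (𝔘.cechDiff_apply P q _ _ α).trans
    (𝔘.sum_pull_cons_of_cechDiff_eq_zero P a hs α))

lemma augment_component {V : QOpen ρ} (a : A) {s : 𝔘.cochains P 0 V}
    (hs : 𝔘.cechDiff P 0 V s = 0) :
    𝔘.augment P (𝔘.box V fun _ : Fin 1 => a) (s.1 fun _ => a) =
      𝔘.cochainsPull P 0 (incl (𝔘.box_le V fun _ : Fin 1 => a)) s := by
  refine Subtype.ext (funext fun α => Eq.trans ?_ (𝔘.sum_pull_cons_of_cechDiff_eq_zero P a hs α))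
  rw [Fin.sum_univ_one, Fin.val_zero, pow_zero, one_smul, ← pull_comp]
  exact 𝔘.pull_congr P s.1 (funext fun i => by rw [Fin.fin_one_eq_zero i, Fin.cons_zero]) _ _
    (mul_one (1 : G)).symm

variable (F : Sheaf (topology ρ) AddCommGrpCat.{u})

lemma cechAugmentation_app (V : QOpen ρ) (s : F.obj.obj (op V)) :
    (((𝔘.cechAugmentation F).f 0).hom.app (op V)).hom s = 𝔘.augment F.obj V s := by
  simp only [cechAugmentation, CochainComplex.fromSingle₀Equiv_symm_apply_f_zero]
  rfl

lemma cechComplex_d_app (q : ℕ) (V : QOpen ρ) (s : 𝔘.cochains F.obj q V) :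
    (((𝔘.cechComplex F).d q (q + 1)).hom.app (op V)).hom s = 𝔘.cechDiff F.obj q V s := by
  rw [cechComplex_d]
  rfl

lemma isResolution_cechAugmentation (hcov : ∀ x : X, ∃ a, x ∈ 𝔘.opens a) :
    IsResolution (𝔘.cechAugmentation F) := by
  have cover (V : QOpen ρ) (x : X) (hx : x ∈ V.carrier) : ∃ a : A,
      ∃ y ∈ (𝔘.box V fun _ : Fin 1 => a).carrier,
        (ρ.act (elt (incl (𝔘.box_le V fun _ : Fin 1 => a)))) y = x := by
    obtain ⟨a, ha⟩ := hcov x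
    exact ⟨a, x, ⟨hx, (𝔘.mem_inter _ _).2 fun _ => ha⟩, act_one_apply ρ x⟩
  refine ⟨?_, ?_, fun q => ?_⟩
  · refine (ShortComplex.exact_iff_mono (ShortComplex.mk (0 : F ⟶ _) ((𝔘.cechAugmentation F).f 0)
      zero_comp) rfl).1 (sheaf_exact_of_locally_exact _ fun V s hs x hx => ?_)
    obtain ⟨a, hy⟩ := cover V x hx
    have h := (𝔘.cechAugmentation_app F V s).symm.trans hs
    exact ⟨_, _, hy, 0, (map_zero _).trans
      (congrArg (fun t : 𝔘.cochains F.obj 0 V => t.1 fun _ => a) h).symm⟩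
  · refine sheaf_exact_of_locally_exact _ fun V s hs x hx => ?_
    obtain ⟨a, hy⟩ := cover V x hx
    exact ⟨_, _, hy, (show 𝔘.cochains F.obj 0 V from s).1 fun _ => a,
      (𝔘.cechAugmentation_app F _ _).trans
        (𝔘.augment_component F.obj a ((𝔘.cechComplex_d_app F 0 V s).symm.trans hs))⟩
  · refine sheaf_exact_of_locally_exact _ fun V s hs x hx => ?_
    obtain ⟨a, hy⟩ := cover V x hx
    exact ⟨_, _, hy, 𝔘.contract F.obj q V a s, (𝔘.cechComplex_d_app F q _ _).trans
      (𝔘.cechDiff_contract F.obj a ((𝔘.cechComplex_d_app F (q + 1) V s).symm.trans hs))⟩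

end EquivariantFamily

lemma existsUnique_iCycles_eq {K : CochainComplex AddCommGrpCat.{u} ℕ} {m : ℕ} {z : K.X m}
    (hz : (K.d m (m + 1)).hom z = 0) : ∃! ζ : K.cycles m, (K.iCycles m).hom ζ = z := by
  have exact := ShortComplex.exact_of_f_is_kernel
    (ShortComplex.mk _ _ (K.iCycles_d m (m + 1))) (K.cyclesIsKernel m (m + 1) (by simp))
  obtain ⟨ζ, hζ⟩ := (ShortComplex.ab_exact_iff _).1 exact z hz
  exact ⟨ζ, hζ, fun ζ' hζ' =>
    (AddCommGrpCat.mono_iff_injective (K.iCycles m)).1 inferInstance (hζ'.trans hζ.symm)⟩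

lemma EquivariantFamily.existsUnique_isClassOf (𝔘 : EquivariantFamily ρ A)
    {F : Sheaf (topology ρ) AddCommGrpCat.{u}} (h : IsResolution (𝔘.cechAugmentation F)) {m : ℕ}
    {z : (𝔘.equivariantCechComplex F).X m}
    (hz : ((𝔘.equivariantCechComplex F).d m (m + 1)).hom z = 0) :
    ∃! c : equivariantCohomology ρ m F, 𝔘.IsClassOf F z c := by
  obtain ⟨ζ, hζ, ζ_unique⟩ := existsUnique_iCycles_eq hz
  have compare {I : InjectiveResolution F} {φ : 𝔘.cechComplex F ⟶ I.cocomplex}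
      (hφ : 𝔘.cechAugmentation F ≫ φ = I.ι) (x : (𝔘.equivariantCechComplex F).homology m) :=
    congrArg (fun k => k.hom x)
      (h.toRightDerived_comp_isoRightDerivedObj_hom (equivariantSections ρ) I hφ m)
  refine ⟨(h.toRightDerived (equivariantSections ρ) m).hom
    (((𝔘.equivariantCechComplex F).homologyπ m).hom ζ), ?_, ?_⟩
  · obtain ⟨φ, hφ⟩ := h.exists_comp_eq (injectiveResolution F).ι
    exact ⟨ζ, _, φ, hζ, hφ, compare hφ _⟩
  · rintro c ⟨ζ', I, φ, hζ', hφ, hc⟩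
    rw [ζ_unique ζ' hζ'] at hc
    exact (AddCommGrpCat.mono_iff_injective
      (I.isoRightDerivedObj (equivariantSections ρ) m).hom).1 inferInstance
        (hc.trans (compare hφ _).symm)

end CechResolution

section Cover

variable {F : Type u} [Field F]

/-- The exponents `β` with `t^β ≡ 1` modulo `I`. -/
noncomputable def unitExponents (I : Ideal (CoordRing F)) : AddSubgroup (𝓞 F) :=
  (((Ideal.Quotient.mk I : CoordRing F →* CoordRing F ⧸ I).comp
    (AddMonoidAlgebra.of ℤ (𝓞 F))).ker).toAddSubgroup'

lemma mem_unitExponents_iff {I : Ideal (CoordRing F)} {β : 𝓞 F} :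
    β ∈ unitExponents I ↔ 1 - monom β ∈ I :=
  eq_comm.trans (Ideal.Quotient.mk_eq_mk_iff_sub_mem _ _)

lemma ker_counit_le_of_unitExponents_eq_top {I : Ideal (CoordRing F)} (hI : unitExponents I = ⊤) :
    RingHom.ker (counit F) ≤ I := by
  have mk_eq : Ideal.Quotient.mk I = (Int.castRingHom (CoordRing F ⧸ I)).comp (counit F) := by
    refine ringHom_ext_monom fun α => ?_
    have hα : 1 - monom α ∈ I := mem_unitExponents_iff.1 (hI ▸ AddSubgroup.mem_top α)
    rw [← Ideal.Quotient.mk_eq_mk_iff_sub_mem, map_one] at hα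
    rw [← hα, RingHom.comp_apply, counit_monom, map_one]
  intro f hf
  rw [← Ideal.Quotient.eq_zero_iff_mem, mk_eq, RingHom.comp_apply, RingHom.mem_ker.1 hf, map_zero]

lemma exists_nsmul_eq_of_notMem_primitives [CharZero F] {α : 𝓞 F} (hα : IsTotPos (α : F))
    (hprim : α ∉ primitives F) :
    ∃ N : ℕ, 1 < N ∧ ∃ β : 𝓞 F, IsTotPos (β : F) ∧ N • β = α := by
  simp only [primitives, Set.mem_ofPred_eq, not_and, not_forall, not_not] at hprim
  obtain ⟨N, hN, β, hβ, hdiv⟩ := hprim hα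
  have hN0 : (N : F) ≠ 0 := Nat.cast_ne_zero.2 (Nat.ne_zero_of_lt hN)
  refine ⟨N, hN, β, hβ, RingOfIntegers.coe_injective ?_⟩
  rw [map_nsmul, nsmul_eq_mul]
  exact (congrArg ((N : F) * ·) hdiv).trans (mul_div_cancel₀ _ hN0)

variable [NumberField F]

lemma natAbs_norm_lt_natAbs_norm_nsmul {N : ℕ} (hN : 1 < N) {β : 𝓞 F} (hβ : β ≠ 0) :
    (Algebra.norm ℤ β).natAbs < (Algebra.norm ℤ (N • β)).natAbs := by
  have hnorm : Algebra.norm ℤ (N : 𝓞 F) = (N : ℤ) ^ finrank ℤ (𝓞 F) := by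
    simpa using Algebra.norm_algebraMap (S := 𝓞 F) (N : ℤ)
  rw [nsmul_eq_mul, map_mul, hnorm, Int.natAbs_mul, Int.natAbs_pow, Int.natAbs_natCast,
    RingOfIntegers.rank]
  exact lt_mul_of_one_lt_left (Int.natAbs_pos.2 (Algebra.norm_ne_zero_iff.2 hβ))
    (Nat.one_lt_pow finrank_pos.ne' hN)

lemma IsTotPos.mem_of_primitives_subset {α : 𝓞 F} (hα : IsTotPos (α : F))
    {H : AddSubgroup (𝓞 F)} (hH : primitives F ⊆ H) : α ∈ H := by
  induction hm : (Algebra.norm ℤ α).natAbs using Nat.strong_induction_on generalizing α with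
  | _ m ih =>
    by_cases hprim : α ∈ primitives F
    · exact hH hprim
    · obtain ⟨N, hN, β, hβ, rfl⟩ := exists_nsmul_eq_of_notMem_primitives hα hprim
      rcases eq_or_ne β 0 with rfl | hβ0
      · simp
      · exact H.nsmul_mem (ih _ (hm ▸ natAbs_norm_lt_natAbs_norm_nsmul hN hβ0) hβ rfl) N

lemma exists_isTotPos_sub_eq (β : 𝓞 F) :
    ∃ γ δ : 𝓞 F, IsTotPos (γ : F) ∧ IsTotPos (δ : F) ∧ γ - δ = β := by
  have : Finite (F →+* ℝ) := Finite.of_injective (fun φ : F →+* ℝ => Complex.ofRealHom.comp φ)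
    fun φ ψ h => RingHom.ext fun x => Complex.ofReal_injective (DFunLike.congr_fun h x)
  obtain ⟨M, hM⟩ := (Set.finite_range fun φ : F →+* ℝ => |φ (β : F)|).bddAbove
  obtain ⟨N, hN⟩ := exists_nat_gt (max M 0)
  have hφ (φ : F →+* ℝ) : |φ (β : F)| < N :=
    (hM ⟨φ, rfl⟩).trans_lt ((le_max_left _ _).trans_lt hN)
  refine ⟨β + N, N, fun φ => ?_, fun φ => ?_, add_sub_cancel_right _ _⟩
  · simpa [neg_lt_iff_pos_add] using (abs_lt.1 (hφ φ)).1
  · simpa using (le_max_right _ _).trans_lt hN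

lemma eq_top_of_primitives_subset {H : AddSubgroup (𝓞 F)} (hH : primitives F ⊆ H) : H = ⊤ := by
  refine eq_top_iff.2 fun β _ => ?_
  obtain ⟨γ, δ, hγ, hδ, rfl⟩ := exists_isTotPos_sub_eq β
  exact H.sub_mem (hγ.mem_of_primitives_subset hH) (hδ.mem_of_primitives_subset hH)

lemma exists_mem_standardCover_opens (x : (puncturedTorus F).toScheme) :
    ∃ a, x ∈ (standardCover F).opens a := by
  by_contra! hx
  let p : PrimeSpectrum (CoordRing F) := (puncturedTorus F).ι x
  have hp : p ∉ Set.range (PrimeSpectrum.comap (counit F)) := x.2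
  have hH : primitives F ⊆ unitExponents p.asIdeal := fun a ha => by
    by_contra hmem
    exact hx ⟨a, ha⟩ fun h => hmem (mem_unitExponents_iff.2 h)
  have hle := ker_counit_le_of_unitExponents_eq_top (eq_top_of_primitives_subset hH)
  rw [range_comap_of_surjective _ (counit F) fun n => ⟨n, by simp⟩] at hp
  exact hp hle

end Cover

section Cones

variable {K : Type*} [Field K] [LinearOrder K] [IsStrictOrderedRing K]

lemma forall_nonneg_sub_mul_iff {ι : Type*} (p c : ι → K) (t : K) :
    (∀ k, 0 ≤ p k - t * c k) ↔ (∀ k, c k = 0 → 0 ≤ p k) ∧ (∀ k, 0 < c k → t ≤ p k / c k) ∧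
      ∀ k, c k < 0 → p k / c k ≤ t := by
  simp only [← forall_and]
  refine forall_congr' fun k => ?_
  rcases lt_trichotomy (c k) 0 with hk | hk | hk
  · simp [hk, hk.ne, hk.not_gt, div_le_iff_of_neg hk]
  · simp [hk]
  · simp [hk, hk.ne', hk.not_gt, le_div_iff₀ hk]

/-- A line in general position which enters the closed orthant also leaves it. -/
lemma sum_sign_mul_orthant_eq_zero {ι : Type*} [Fintype ι] (p c : ι → K)
    (hpos : ∃ j, 0 < c j) (hneg : ∃ j, c j < 0)
    (hinj : Set.InjOn (fun j => p j / c j) {j | c j ≠ 0}) :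
    ∑ j, (SignType.sign (c j) : ℤ) * (if ∀ k, 0 ≤ p k - p j / c j * c k then 1 else 0) = 0 := by
  obtain ⟨a, ha, hmin⟩ := Set.exists_min_image {j | 0 < c j} (fun j => p j / c j)
    (Set.toFinite _) hpos
  obtain ⟨b, hb, hmax⟩ := Set.exists_max_image {j | c j < 0} (fun j => p j / c j)
    (Set.toFinite _) hneg
  have hab : a ≠ b := fun h => lt_asymm ha (h ▸ hb)
  have mem_iff (t : K) : (∀ k, 0 ≤ p k - t * c k) ↔
      (∀ k, c k = 0 → 0 ≤ p k) ∧ t ≤ p a / c a ∧ p b / c b ≤ t := by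
    rw [forall_nonneg_sub_mul_iff]
    exact and_congr_right' (and_congr ⟨fun h => h a ha, fun h k hk => h.trans (hmin k hk)⟩
      ⟨fun h => h b hb, fun h k hk => (hmax k hk).trans h⟩)
  simp only [mem_iff]
  rw [Fintype.sum_eq_add a b hab, sign_pos ha, sign_neg hb]
  · simp only [le_refl, true_and, and_true, SignType.coe_one, SignType.coe_neg, one_mul,
      neg_one_mul, add_neg_cancel]
  · rintro j ⟨hja, hjb⟩
    rcases lt_trichotomy (c j) 0 with hj | hj | hj
    · rw [if_neg, mul_zero]
      exact fun h => hjb (hinj hj.ne hb.ne (le_antisymm (hmax j hj) h.2.2))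
    · simp [hj]
    · rw [if_neg, mul_zero]
      exact fun h => hja (hinj hj.ne' ha.ne' (le_antisymm h.2.1 (hmin j hj)))

variable {n : ℕ}

/-- The linear relation between the columns of `B` whose coefficients are the signed maximal minors
of `B`. -/
def signedMinor {R : Type*} [CommRing R] (B : Matrix (Fin n) (Fin (n + 1)) R) (j : Fin (n + 1)) :
    R :=
  (-1) ^ (j : ℕ) * (B.submatrix id j.succAbove).det

lemma mulVec_signedMinor {R : Type*} [CommRing R] (B : Matrix (Fin n) (Fin (n + 1)) R) :
    B.mulVec (signedMinor B) = 0 := by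
  funext i
  let A : Matrix (Fin (n + 1)) (Fin (n + 1)) R := Matrix.of (Fin.cons (B i) B)
  have hA : A.det = 0 := Matrix.det_zero_of_row_eq (Fin.succ_ne_zero i).symm rfl
  rw [Matrix.det_succ_row_zero] at hA
  rw [Pi.zero_apply, ← hA, Matrix.mulVec, dotProduct]
  refine Finset.sum_congr rfl fun j _ => ?_
  exact (mul_left_comm (B i j) ((-1) ^ (j : ℕ)) _).trans (mul_assoc _ _ _).symm

lemma sign_signedMinor (B : Matrix (Fin n) (Fin (n + 1)) K) (j : Fin (n + 1)) :
    (SignType.sign (signedMinor B j) : ℤ) =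
      (-1) ^ (j : ℕ) * SignType.sign (B.submatrix id j.succAbove).det := by
  rcases Nat.even_or_odd (j : ℕ) with hj | hj <;> simp [signedMinor, hj.neg_one_pow, Left.sign_neg]

lemma mulVec_eq_add_mulVec_succAbove {R : Type*} [CommRing R]
    (B : Matrix (Fin n) (Fin (n + 1)) R) (j : Fin (n + 1)) (x : Fin (n + 1) → R) :
    B.mulVec x = x j • B.col j + (B.submatrix id j.succAbove).mulVec (x ∘ j.succAbove) := by
  funext i
  simp only [Matrix.mulVec, dotProduct, Fin.sum_univ_succAbove _ j, Pi.add_apply, Pi.smul_apply,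
    Matrix.col_apply, smul_eq_mul, mul_comm (x j), Matrix.submatrix_apply, id_eq,
    Function.comp_apply]

/-- The solutions `x` of `B x = v` form a line with direction `signedMinor B`; the coordinates with
respect to all columns but the `j`-th belong to its point with `x j = 0`. -/
lemma inv_submatrix_mulVec {k : Type*} [Field k] {B : Matrix (Fin n) (Fin (n + 1)) k}
    {j : Fin (n + 1)} (hj : signedMinor B j ≠ 0) (p : Fin (n + 1) → k) (l : Fin n) :
    ((B.submatrix id j.succAbove)⁻¹.mulVec (B.mulVec p)) l =
      p (j.succAbove l) - p j / signedMinor B j * signedMinor B (j.succAbove l) := by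
  let x : Fin (n + 1) → k := p - (p j / signedMinor B j) • signedMinor B
  have hxj : x j = 0 := by simp [x, div_mul_cancel₀ _ hj]
  have hx : B.mulVec p = (B.submatrix id j.succAbove).mulVec (x ∘ j.succAbove) := by
    rw [← zero_add ((B.submatrix id j.succAbove).mulVec _), ← zero_smul k (B.col j), ← hxj,
      ← mulVec_eq_add_mulVec_succAbove, Matrix.mulVec_sub, Matrix.mulVec_smul, mulVec_signedMinor,
      smul_zero, sub_zero]
  have hdet : IsUnit (B.submatrix id j.succAbove).det := (right_ne_zero_of_mul hj).isUnit
  rw [hx, Matrix.mulVec_mulVec, Matrix.nonsing_inv_mul _ hdet, Matrix.one_mulVec]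
  rfl

lemma exists_signedMinor_pos_and_neg {B : Matrix (Fin n) (Fin (n + 1)) K} {w : Fin n → K}
    (hw : ∀ j, 0 < (Matrix.vecMul w B) j) (hB : signedMinor B ≠ 0) :
    (∃ j, 0 < signedMinor B j) ∧ ∃ j, signedMinor B j < 0 := by
  have hsum : ∑ j, Matrix.vecMul w B j * signedMinor B j = 0 := by
    change Matrix.vecMul w B ⬝ᵥ signedMinor B = 0
    rw [← Matrix.dotProduct_mulVec, mulVec_signedMinor, dotProduct_zero]
  obtain ⟨j₀, hj₀⟩ := Function.ne_iff.1 hB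
  have hne : ∃ j ∈ Finset.univ, Matrix.vecMul w B j * signedMinor B j ≠ 0 :=
    ⟨j₀, Finset.mem_univ _, mul_ne_zero (hw j₀).ne' hj₀⟩
  obtain ⟨i, -, hi⟩ := Finset.exists_pos_of_sum_zero_of_exists_nonzero _ hsum hne
  obtain ⟨k, -, hk⟩ := Finset.exists_pos_of_sum_zero_of_exists_nonzero _
    ((Finset.sum_neg_distrib _).trans (neg_eq_zero.2 hsum)) (by simpa only [neg_ne_zero] using hne)
  exact ⟨⟨i, (pos_iff_pos_of_mul_pos hi).1 (hw i)⟩,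
    ⟨k, neg_of_mul_neg_right (neg_pos.1 hk) (hw k).le⟩⟩

lemma sum_sign_det_mul_cone_eq_zero {B : Matrix (Fin n) (Fin (n + 1)) K} {w : Fin n → K}
    (hw : ∀ j, 0 < (Matrix.vecMul w B) j) (v : Fin n → K)
    (hv : ∀ j, (B.submatrix id (Fin.succAbove j)).det ≠ 0 →
      ∀ k, ((B.submatrix id (Fin.succAbove j))⁻¹.mulVec v) k ≠ 0) :
    ∑ j : Fin (n + 1), (-1 : ℤ) ^ (j : ℕ) * SignType.sign (B.submatrix id j.succAbove).det *
      (if ∀ k, 0 ≤ ((B.submatrix id j.succAbove)⁻¹.mulVec v) k then 1 else 0) = 0 := by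
  simp only [← sign_signedMinor]
  rcases eq_or_ne (signedMinor B) 0 with hB | hB
  · simp [hB]
  obtain ⟨hpos, hneg⟩ := exists_signedMinor_pos_and_neg hw hB
  obtain ⟨j₀, hj₀⟩ := hpos
  have hdet (j) (hj : signedMinor B j ≠ 0) : (B.submatrix id j.succAbove).det ≠ 0 :=
    right_ne_zero_of_mul hj
  obtain ⟨p, rfl⟩ : ∃ p, B.mulVec p = v := by
    refine ⟨j₀.insertNth 0 ((B.submatrix id j₀.succAbove)⁻¹.mulVec v), ?_⟩
    rw [mulVec_eq_add_mulVec_succAbove B j₀, Fin.insertNth_apply_same, zero_smul, zero_add,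
      Fin.insertNth_comp_succAbove, Matrix.mulVec_mulVec,
      Matrix.mul_nonsing_inv _ (hdet j₀ hj₀.ne').isUnit, Matrix.one_mulVec]
  refine Eq.trans ?_ (sum_sign_mul_orthant_eq_zero p (signedMinor B) ⟨j₀, hj₀⟩ hneg ?_)
  · refine Finset.sum_congr rfl fun j _ => ?_
    rcases eq_or_ne (signedMinor B j) 0 with hj | hj
    · simp [hj]
    · simp [Fin.forall_iff_succAbove j, inv_submatrix_mulVec hj, div_mul_cancel₀ _ hj]
  · intro j hj k hk hjk
    by_contra hne
    obtain ⟨l, rfl⟩ := Fin.exists_succAbove_eq (Ne.symm hne)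
    refine hv j (hdet j hj) l ?_
    rw [inv_submatrix_mulVec hj, show p j / _ = _ from hjk, div_mul_cancel₀ _ hk, sub_self]

end Cones

section InfinitesimalSign

/-- The condition that `x - δ y` is positive for all small `δ > 0`, in the form in which it depends
on the signs of `x` and `y`. -/
def GermPos (y x : ℝ) : Prop := 0 < x ∨ x = 0 ∧ y < 0

lemma GermPos.nonneg {y x : ℝ} (h : GermPos y x) : 0 ≤ x :=
  h.elim le_of_lt fun h => h.1.ge

lemma GermPos.eventually_pos {y x : ℝ} (h : GermPos y x) : ∀ᶠ δ in 𝓝[>] 0, 0 < x - δ * y := by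
  rcases h with hx | ⟨rfl, hy⟩
  · have hlim : Tendsto (fun δ : ℝ => x - δ * y) (𝓝[>] 0) (𝓝 (x - 0 * y)) :=
      (by fun_prop : Continuous fun δ : ℝ => x - δ * y).continuousWithinAt
    exact hlim.eventually_const_lt (by simpa using hx)
  · filter_upwards [self_mem_nhdsWithin] with δ hδ
    simpa using mul_neg_of_pos_of_neg hδ hy

lemma germPos_neg_of_not_germPos {y x : ℝ} (hy : y ≠ 0) (h : ¬ GermPos y x) :
    GermPos (-y) (-x) := by
  simp only [GermPos, not_or, not_and, not_lt, neg_pos, neg_eq_zero, neg_neg_iff_pos] at h ⊢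
  exact h.1.lt_or_eq.imp_right fun hx => ⟨hx, (h.2 hx).lt_of_ne' hy⟩

lemma eventually_germPos_iff {y : ℝ} (hy : y ≠ 0) (x : ℝ) :
    ∀ᶠ δ in 𝓝[>] 0, (GermPos y x ↔ 0 ≤ x - δ * y) ∧ x - δ * y ≠ 0 := by
  by_cases h : GermPos y x
  · filter_upwards [h.eventually_pos] with δ hδ
    exact ⟨iff_of_true h hδ.le, hδ.ne'⟩
  · filter_upwards [(germPos_neg_of_not_germPos hy h).eventually_pos] with δ hδ
    have hneg : x - δ * y < 0 := by linarith
    exact ⟨iff_of_false h hneg.not_ge, hneg.ne⟩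

end InfinitesimalSign

section EmbeddingMatrix

variable {F : Type u} [Field F] {ι : Type*} (τ : ι ≃ (F →+* ℝ))

/-- The matrix `(x_j^{τ_i})_{i, j}` of the conjugates of a family of elements. -/
def embedMatrix {κ : Type*} (x : κ → F) : Matrix ι κ ℝ :=
  Matrix.of fun i j => τ i (x j)

lemma embedMatrix_comp {κ κ' : Type*} (x : κ → F) (f : κ' → κ) :
    embedMatrix τ (x ∘ f) = (embedMatrix τ x).submatrix id f :=
  rfl

variable [Fintype ι]

lemma sum_realEmbeddings_eq_trace [NumberField F] (hι : finrank ℚ F = Fintype.card ι) (x : F) :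
    ∑ i, τ i x = Algebra.trace ℚ F x := by
  let f (i : ι) : F →ₐ[ℚ] ℂ := (Complex.ofRealHom.comp (τ i)).toRatAlgHom
  have hf : Function.Injective f := fun i j hij => τ.injective <| RingHom.ext fun x =>
    Complex.ofReal_injective (DFunLike.congr_fun hij x)
  have hf' : Function.Bijective f :=
    (Fintype.bijective_iff_injective_and_card f).2 ⟨hf, by rw [← hι, AlgHom.card]⟩
  have htrace := trace_eq_sum_embeddings (K := ℚ) (L := F) ℂ (x := x)
  rw [← hf'.sum_comp fun φ : F →ₐ[ℚ] ℂ => φ x] at htrace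
  apply Complex.ofReal_injective
  rw [Complex.ofReal_sum]
  exact htrace.symm

variable [NumberField F]

lemma map_traceMatrix (hι : finrank ℚ F = Fintype.card ι) {κ : Type*} (x : κ → F) :
    (Algebra.traceMatrix ℚ x).map (algebraMap ℚ ℝ) =
      (embedMatrix τ x).transpose * embedMatrix τ x := by
  ext j l
  simp only [Matrix.map_apply, Algebra.traceMatrix_apply, Algebra.traceForm_apply,
    eq_ratCast, ← sum_realEmbeddings_eq_trace τ hι, map_mul]
  rfl

variable [DecidableEq ι]

/-- The rows of the inverse consist of the conjugates of the dual basis with respect to the trace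
form. -/
lemma exists_embedMatrix_inv_eq (hι : finrank ℚ F = Fintype.card ι) {x : ι → F}
    (hx : (embedMatrix τ x).det ≠ 0) (k : ι) :
    ∃ γ : F, ∀ i, (embedMatrix τ x)⁻¹ k i = τ i γ := by
  let T := Algebra.traceMatrix ℚ x
  have hTdet : IsUnit T.det := by
    have hdet : algebraMap ℚ ℝ T.det = (embedMatrix τ x).det * (embedMatrix τ x).det := by
      rw [RingHom.map_det, RingHom.mapMatrix_apply, map_traceMatrix τ hι, Matrix.det_mul,
        Matrix.det_transpose]
    exact isUnit_iff_ne_zero.2 ((map_ne_zero _).1 (hdet ▸ mul_ne_zero hx hx))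
  have hinv : (embedMatrix τ x)⁻¹ = T⁻¹.map (algebraMap ℚ ℝ) * (embedMatrix τ x).transpose := by
    refine Matrix.inv_eq_left_inv ?_
    rw [Matrix.mul_assoc, ← map_traceMatrix τ hι, ← Matrix.map_mul, Matrix.nonsing_inv_mul _ hTdet,
      Matrix.map_one _ (map_zero _) (map_one _)]
  refine ⟨∑ j, algebraMap ℚ F (T⁻¹ k j) * x j, fun i => ?_⟩
  rw [hinv, Matrix.mul_apply, map_sum]
  exact Finset.sum_congr rfl fun j _ => by simp [embedMatrix]

lemma embedMatrix_inv_ne_zero (hι : finrank ℚ F = Fintype.card ι) {x : ι → F}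
    (hx : (embedMatrix τ x).det ≠ 0) (k i : ι) : (embedMatrix τ x)⁻¹ k i ≠ 0 := by
  obtain ⟨γ, hγ⟩ := exists_embedMatrix_inv_eq τ hι hx k
  intro hki
  have hγ0 : γ = 0 := (map_eq_zero (τ i)).1 ((hγ i).symm.trans hki)
  have hrow : ((embedMatrix τ x)⁻¹ * embedMatrix τ x) k k = 0 := by
    simp [Matrix.mul_apply, hγ, hγ0]
  rw [Matrix.nonsing_inv_mul _ hx.isUnit, Matrix.one_apply_eq] at hrow
  exact one_ne_zero hrow

end EmbeddingMatrix

section DisplacedCones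

variable {F : Type u} [Field F] {ι : Type*} [Fintype ι] [DecidableEq ι] (τ : ι ≃ (F →+* ℝ))

/-- The coordinates of `(β^{τ_i})_i` with respect to the vectors `(x_j^{τ_i})_i`; junk unless these
form a basis. -/
noncomputable def coords (x : ι → F) (β : F) : ι → ℝ :=
  (embedMatrix τ x)⁻¹.mulVec fun i => τ i β

/-- Membership in the closed cone spanned by the family `x` after an infinitesimal displacement in
the negative direction of the coordinate `l`. -/
def InCone (l : ι) (x : ι → F) (β : F) : Prop :=
  ∀ k, GermPos ((embedMatrix τ x)⁻¹ k l) (coords τ x β k)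

lemma inv_embedMatrix_mulVec_sub_single (l : ι) (x : ι → F) (β : F) (δ : ℝ) (k : ι) :
    (embedMatrix τ x)⁻¹.mulVec ((fun i => τ i β) - Pi.single l δ) k =
      coords τ x β k - δ * (embedMatrix τ x)⁻¹ k l := by
  rw [Matrix.mulVec_sub, Pi.sub_apply, Matrix.mulVec_single]
  simp [coords, mul_comm]

variable {τ} {x : ι → F}

lemma coords_sub (hx : (embedMatrix τ x).det ≠ 0) (β : F) (k : ι) :
    coords τ x (β - x k) = coords τ x β - Pi.single k 1 := by
  have hsub : (fun i => τ i (β - x k)) =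
      (fun i => τ i β) - (embedMatrix τ x).mulVec (Pi.single k 1) := by
    funext i
    simp [embedMatrix]
  rw [coords, hsub, Matrix.mulVec_sub, Matrix.mulVec_mulVec, Matrix.nonsing_inv_mul _ hx.isUnit,
    Matrix.one_mulVec, coords]

lemma InCone.isTotPos {l : ι} {β : F} (h : InCone τ l x β) (hx : (embedMatrix τ x).det ≠ 0)
    (hpos : ∀ j, IsTotPos (x j)) : IsTotPos β := by
  intro φ
  obtain ⟨i, rfl⟩ := τ.surjective φ
  obtain ⟨δ, hδ, hδ0 : 0 < δ⟩ :=
    ((eventually_all.2 fun k => (h k).eventually_pos).and self_mem_nhdsWithin).exists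
  have hmul : (embedMatrix τ x).mulVec ((embedMatrix τ x)⁻¹.mulVec
      ((fun i => τ i β) - Pi.single l δ)) = (fun i => τ i β) - Pi.single l δ := by
    rw [Matrix.mulVec_mulVec, Matrix.mul_nonsing_inv _ hx.isUnit, Matrix.one_mulVec]
  have hsum : 0 < ((fun i => τ i β) - Pi.single l δ : ι → ℝ) i := by
    rw [← hmul]
    refine Finset.sum_pos (fun k _ => mul_pos (hpos k (τ i)) ?_) ⟨l, Finset.mem_univ l⟩
    rw [inv_embedMatrix_mulVec_sub_single]
    exact hδ k
  have hsingle : (0 : ι → ℝ) ≤ Pi.single l δ := Pi.single_nonneg.2 hδ0.le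
  exact hsum.trans_le (sub_le_self _ (hsingle i))

variable [NumberField F]

lemma eventually_forall_germPos_coords_iff (hι : finrank ℚ F = Fintype.card ι) (l : ι)
    (hx : (embedMatrix τ x).det ≠ 0) (c : ι → ℝ) :
    ∀ᶠ δ in 𝓝[>] (0 : ℝ), ∀ k,
      (GermPos ((embedMatrix τ x)⁻¹ k l) (c k) ↔ 0 ≤ c k - δ * (embedMatrix τ x)⁻¹ k l) ∧
        c k - δ * (embedMatrix τ x)⁻¹ k l ≠ 0 :=
  eventually_all.2 fun k => eventually_germPos_iff (embedMatrix_inv_ne_zero τ hι hx k l) _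

lemma sum_sign_det_mul_inCone_eq_zero {n : ℕ} (τ : Fin n ≃ (F →+* ℝ)) (hn : finrank ℚ F = n)
    (l : Fin n) {x : Fin (n + 1) → F} (hx : ∀ j, 0 < τ l (x j)) (β : F)
    [∀ j : Fin (n + 1), Decidable (InCone τ l (x ∘ j.succAbove) β)] :
    ∑ j : Fin (n + 1), (-1 : ℤ) ^ (j : ℕ) *
      SignType.sign (embedMatrix τ (x ∘ j.succAbove)).det *
        (if InCone τ l (x ∘ j.succAbove) β then 1 else 0) = 0 := by
  have hev (j : Fin (n + 1)) : ∀ᶠ δ in 𝓝[>] (0 : ℝ), (embedMatrix τ (x ∘ j.succAbove)).det ≠ 0 →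
      ∀ k, (GermPos ((embedMatrix τ (x ∘ j.succAbove))⁻¹ k l) (coords τ (x ∘ j.succAbove) β k) ↔
        0 ≤ (embedMatrix τ (x ∘ j.succAbove))⁻¹.mulVec ((fun i => τ i β) - Pi.single l δ) k) ∧
        (embedMatrix τ (x ∘ j.succAbove))⁻¹.mulVec ((fun i => τ i β) - Pi.single l δ) k ≠ 0 := by
    rw [eventually_imp_distrib_left]
    intro hj
    simp only [inv_embedMatrix_mulVec_sub_single]
    exact eventually_forall_germPos_coords_iff (by simpa using hn) l hj _
  obtain ⟨δ, hδ⟩ := (eventually_all.2 hev).exists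
  have hw (j : Fin (n + 1)) : 0 < Matrix.vecMul (Pi.single l 1) (embedMatrix τ x) j := by
    simpa [embedMatrix] using hx j
  have hcone := sum_sign_det_mul_cone_eq_zero hw ((fun i => τ i β) - Pi.single l δ)
    fun j hj k => by rw [← embedMatrix_comp] at hj ⊢; exact (hδ j hj k).2
  refine (Finset.sum_congr rfl fun j _ => ?_).trans hcone
  rw [← embedMatrix_comp]
  rcases eq_or_ne (embedMatrix τ (x ∘ j.succAbove)).det 0 with hj | hj
  · simp [hj]
  · exact congrArg _ (if_congr (forall_congr' fun k => (hδ j hj k).1) rfl rfl)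

end DisplacedCones

section LatticePoints

variable {F : Type u} [Field F] {n : ℕ} (τ : Fin (n + 1) ≃ (F →+* ℝ))

/-- The family of elements of `F` underlying a family of primitive integers. -/
abbrev vectors {κ : Type*} (α : κ → primitives F) (j : κ) : F := ((α j).1 : F)

variable {τ} {α : Fin (n + 1) → primitives F}

lemma mem_parallelepiped_iff (hα : (embedMatrix τ (vectors α)).det ≠ 0) (u : Fin (n + 1) → ℝ) :
    u ∈ parallelepiped τ α ↔ ∀ k, 0 ≤ ((embedMatrix τ (vectors α))⁻¹.mulVec u) k ∧
      ((embedMatrix τ (vectors α))⁻¹.mulVec u) k < 1 := by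
  have hsum (y : Fin (n + 1) → ℝ) :
      ∑ j, y j • embed τ ((α j).1 : F) = (embedMatrix τ (vectors α)).mulVec y := by
    funext i
    simp [embedMatrix, embed, Matrix.mulVec, dotProduct, mul_comm]
  constructor
  · rintro ⟨y, hy, rfl⟩
    rwa [hsum, Matrix.mulVec_mulVec, Matrix.nonsing_inv_mul _ hα.isUnit, Matrix.one_mulVec]
  · refine fun h => ⟨_, h, ?_⟩
    rw [hsum, Matrix.mulVec_mulVec, Matrix.mul_nonsing_inv _ hα.isUnit, Matrix.one_mulVec]

lemma mem_upperClosure_iff {R : Set (Fin (n + 1) → ℝ)} {u : Fin (n + 1) → ℝ} :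
    u ∈ upperClosure R ↔
      (∀ i, 0 < u i) ∧ ∀ᶠ δ in 𝓝[>] (0 : ℝ), u - Pi.single (Fin.last n) δ ∈ R := by
  rw [Filter.Eventually, mem_nhdsGT_iff_exists_Ioo_subset]
  exact and_congr_right' ⟨fun ⟨δ, hδ, h⟩ => ⟨δ, hδ, fun x hx => h x hx.1 hx.2⟩,
    fun ⟨δ, hδ, h⟩ => ⟨δ, hδ, fun x hx₀ hx => h ⟨hx₀, hx⟩⟩⟩

lemma mem_latticePoints_iff [NumberField F] (hn : finrank ℚ F = n + 1)
    (hα : (embedMatrix τ (vectors α)).det ≠ 0) (β : 𝓞 F) :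
    β ∈ latticePoints τ α ↔ ∀ k,
      GermPos ((embedMatrix τ (vectors α))⁻¹ k (Fin.last n)) (coords τ (vectors α) β k) ∧
      ¬ GermPos ((embedMatrix τ (vectors α))⁻¹ k (Fin.last n))
        (coords τ (vectors α) β k - 1) := by
  have hι : finrank ℚ F = Fintype.card (Fin (n + 1)) := by simpa using hn
  have hmem : ∀ᶠ δ in 𝓝[>] (0 : ℝ),
      (embed τ (β : F) - Pi.single (Fin.last n) δ ∈ parallelepiped τ α ↔ ∀ k,
        GermPos ((embedMatrix τ (vectors α))⁻¹ k (Fin.last n)) (coords τ (vectors α) β k) ∧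
        ¬ GermPos ((embedMatrix τ (vectors α))⁻¹ k (Fin.last n))
          (coords τ (vectors α) β k - 1)) := by
    filter_upwards [eventually_forall_germPos_coords_iff hι (Fin.last n) hα (coords τ _ β),
      eventually_forall_germPos_coords_iff hι (Fin.last n) hα fun k => coords τ _ β k - 1]
      with δ hδ hδ'
    refine (mem_parallelepiped_iff hα _).trans (forall_congr' fun k => ?_)
    rw [(hδ k).1, (hδ' k).1, not_le, sub_right_comm, sub_neg, ← inv_embedMatrix_mulVec_sub_single]
    rfl
  refine mem_upperClosure_iff.trans ?_
  rw [eventually_congr hmem, eventually_const]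
  exact and_iff_right_of_imp fun h i =>
    InCone.isTotPos (fun k => (h k).1) hα (fun j => (α j).2.1) (τ i)

end LatticePoints

section Shift

variable (R : Type*) {G : Type*} [CommRing R] [AddCommGroup G]

/-- The action of the group ring on functions by translation, `(t^g h)(x) = h(x - g)`, which extends
its multiplication from finitely supported functions to all functions. -/
noncomputable def shift : AddMonoidAlgebra R G →ₐ[R] Module.End R (G → R) :=
  AddMonoidAlgebra.lift R (Module.End R (G → R)) G
    { toFun := fun g => LinearMap.funLeft R R fun x => x - g.toAdd
      map_one' := by ext h x; simp [LinearMap.funLeft]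
      map_mul' := fun g g' => by
        refine LinearMap.ext fun h => funext fun x => ?_
        simp [LinearMap.funLeft, sub_sub] }

variable {R}

lemma shift_single (g : G) (r : R) (h : G → R) (x : G) :
    shift R (AddMonoidAlgebra.single g r) h x = r * h (x - g) := by
  simp [shift, LinearMap.funLeft]

lemma shift_one_sub_single_one (g : G) (h : G → R) (x : G) :
    shift R (1 - AddMonoidAlgebra.single g 1) h x = h x - h (x - g) := by
  rw [map_sub, map_one, LinearMap.sub_apply, Pi.sub_apply, shift_single, one_mul,
    Module.End.one_apply]

lemma coeff_mul_eq_shift (f f' : AddMonoidAlgebra R G) :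
    ((f * f').coeff : G → R) = shift R f f'.coeff := by
  induction f using AddMonoidAlgebra.induction_linear with
  | zero => simp
  | add f₁ f₂ h₁ h₂ =>
    rw [add_mul, AddMonoidAlgebra.coeff_add, Finsupp.coe_add, h₁, h₂, map_add, LinearMap.add_apply]
  | single g r =>
    funext x
    rw [shift_single, AddMonoidAlgebra.coeff_single_mul_apply, sub_eq_neg_add]

/-- If `f` is a product of functions of one coordinate each, and `t^{g_k}` translates the `k`-th
coordinate by one, then multiplication by `1 - t^{g_k}` takes differences in the `k`-th factor. -/
lemma shift_prod_one_sub_single {ι A : Type*} [Fintype ι] [DecidableEq ι] [AddGroupWithOne A]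
    {g : ι → G} {c : G → ι → A} (hc : ∀ x k, c (x - g k) = c x - Pi.single k 1)
    (h : ι → A → R) (S : Finset ι) :
    shift R (∏ k ∈ S, (1 - AddMonoidAlgebra.single (g k) 1)) (fun x => ∏ k, h k (c x k)) =
      fun x => ∏ k, S.piecewise (fun k a => h k a - h k (a - 1)) h k (c x k) := by
  induction S using Finset.induction_on with
  | empty => simp
  | insert a S ha ih =>
    funext x
    let Δh (k : ι) (y : A) : R := h k y - h k (y - 1)
    have hcompl (y : ι → A) (hy : ∀ k ≠ a, y k = c x k) :
        ∏ k ∈ {a}ᶜ, S.piecewise Δh h k (y k) =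
          ∏ k ∈ {a}ᶜ, (insert a S).piecewise Δh h k (c x k) :=
      Finset.prod_congr rfl fun k hk => by
        have hka : k ≠ a := by simpa using hk
        rw [Finset.piecewise_insert_of_ne _ _ _ hka, hy k hka]
    rw [Finset.prod_insert ha, map_mul, Module.End.mul_apply, ih, shift_one_sub_single_one]
    rw [hc, Fintype.prod_eq_mul_prod_compl a, Fintype.prod_eq_mul_prod_compl a,
      Fintype.prod_eq_mul_prod_compl a, hcompl _ fun _ _ => rfl,
      hcompl _ fun k hk => by simp [hk], ← sub_mul]
    simp [ha, Δh]

lemma shift_prod_univ_one_sub_single {ι A : Type*} [Fintype ι] [AddGroupWithOne A]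
    [DecidableEq ι] {g : ι → G} {c : G → ι → A} (hc : ∀ x k, c (x - g k) = c x - Pi.single k 1)
    (h : ι → A → R) (x : G) :
    shift R (∏ k, (1 - AddMonoidAlgebra.single (g k) 1)) (fun x => ∏ k, h k (c x k)) x =
      ∏ k, (h k (c x k) - h k (c x k - 1)) := by
  rw [shift_prod_one_sub_single hc]
  simp

end Shift

section Denominator

variable {F : Type u} [Field F] {κ : Type*} [Fintype κ]

/-- The denominator `(1 - t^{α_1}) ⋯ (1 - t^{α_g})` of the generating function `𝒢_{σ_α}`. -/
noncomputable def denominator (α : κ → primitives F) : CoordRing F :=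
  ∏ k, (1 - monom (α k).1)

lemma denominator_comp_perm (σ : Equiv.Perm κ) (α : κ → primitives F) :
    denominator (α ∘ σ) = denominator α :=
  Equiv.prod_comp σ fun k => (1 - monom (α k).1 : CoordRing F)

lemma denominator_eq_mul_succAbove {n : ℕ} (α : Fin (n + 1) → primitives F) (j : Fin (n + 1)) :
    denominator α = (1 - monom (α j).1) * denominator (α ∘ j.succAbove) :=
  Fin.prod_univ_succAbove _ j

lemma actRing_denominator (ε : totPosUnits F) (α : κ → primitives F) :
    actRing ε (denominator α) = denominator (ε • α) := by
  simp [denominator, actRing_monom, primitives_smul_val]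

end Denominator

section GeneratingFunctions

variable {F : Type u} [Field F] {n : ℕ} (τ : Fin (n + 1) ≃ (F →+* ℝ))

open Classical in
/-- The coefficients of the generating function of all integers in a cone, displaced in the last
coordinate direction as in `upperClosure`. -/
noncomputable def coneIndicator (α : Fin (n + 1) → primitives F) (β : 𝓞 F) : ℤ :=
  if InCone τ (Fin.last n) (vectors α) β then 1 else 0

open Classical in
lemma shift_prod_coneIndicator {α : Fin (n + 1) → primitives F}
    (hα : (embedMatrix τ (vectors α)).det ≠ 0) (β : 𝓞 F) :
    shift ℤ (denominator α) (coneIndicator τ α) β =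
      if ∀ k, GermPos ((embedMatrix τ (vectors α))⁻¹ k (Fin.last n)) (coords τ (vectors α) β k) ∧
        ¬ GermPos ((embedMatrix τ (vectors α))⁻¹ k (Fin.last n)) (coords τ (vectors α) β k - 1)
      then 1 else 0 := by
  let y (k : Fin (n + 1)) : ℝ := (embedMatrix τ (vectors α))⁻¹ k (Fin.last n)
  have hprod : coneIndicator τ α =
      fun (β : 𝓞 F) => ∏ k, if GermPos (y k) (coords τ (vectors α) β k) then (1 : ℤ) else 0 :=
    funext fun β => by
      simp only [coneIndicator, Fintype.prod_boole]
      congr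
  have hsub (β : 𝓞 F) (k) : coords τ (vectors α) (β - (α k).1 : 𝓞 F) =
      coords τ (vectors α) β - Pi.single k 1 := coords_sub hα _ k
  have hdiff (k) (x : ℝ) : ((if GermPos (y k) x then 1 else 0) -
      if GermPos (y k) (x - 1) then 1 else 0 : ℤ) =
        if GermPos (y k) x ∧ ¬ GermPos (y k) (x - 1) then 1 else 0 := by
    have hmono (h : GermPos (y k) (x - 1)) : GermPos (y k) x :=
      .inl (one_pos.trans_le (sub_nonneg.1 h.nonneg))
    by_cases h : GermPos (y k) (x - 1)
    · simp [h, hmono h]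
    · simp [h]
  rw [hprod]
  refine (shift_prod_univ_one_sub_single hsub
    (fun k x => if GermPos (y k) x then 1 else 0) β).trans ?_
  simp only [hdiff, Fintype.prod_boole]
  congr

lemma sgn_eq_zero {α : Fin (n + 1) → primitives F} (hα : (embedMatrix τ (vectors α)).det = 0) :
    sgn τ α = 0 := by
  change (SignType.sign (embedMatrix τ (vectors α)).det : ℤ) = 0
  rw [hα, sign_zero, SignType.coe_zero]

variable [NumberField F]

lemma sum_sgn_smul_coneIndicator_eq_zero (hn : finrank ℚ F = n + 1)
    (α : Fin (n + 2) → primitives F) :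
    ∑ j : Fin (n + 2), ((-1 : ℤ) ^ (j : ℕ) * sgn τ (α ∘ j.succAbove)) •
      coneIndicator τ (α ∘ j.succAbove) = 0 := by
  classical
  funext β
  rw [Finset.sum_apply]
  exact sum_sign_det_mul_inCone_eq_zero τ hn (Fin.last n) (x := vectors α)
    (fun j => (α j).2.1 _) β

variable [IsTotallyReal F]

/-- The numerator of the generating function `𝒢_{σ_α}`. -/
noncomputable def numerator (α : Fin (n + 1) → primitives F) : CoordRing F :=
  ∑ β ∈ (finite_latticePoints τ α).toFinset, monom β

lemma coeff_numerator (hn : finrank ℚ F = n + 1) {α : Fin (n + 1) → primitives F}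
    (hα : (embedMatrix τ (vectors α)).det ≠ 0) :
    ((numerator τ α).coeff : 𝓞 F → ℤ) =
      shift ℤ (denominator α) (coneIndicator τ α) := by
  classical
  funext β
  rw [shift_prod_coneIndicator τ hα, numerator, AddMonoidAlgebra.coeff_sum,
    Finsupp.finsetSum_apply]
  simp [monom, AddMonoidAlgebra.coeff_single, Finsupp.single_apply, mem_latticePoints_iff hn hα]

lemma sum_sgn_smul_numerator_eq_zero (hn : finrank ℚ F = n + 1) (α : Fin (n + 2) → primitives F) :
    ∑ j : Fin (n + 2), ((-1 : ℤ) ^ (j : ℕ) * sgn τ (α ∘ j.succAbove)) •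
      ((1 - monom (α j).1) * numerator τ (α ∘ j.succAbove)) = 0 := by
  have hterm (j : Fin (n + 2)) : ((((-1 : ℤ) ^ (j : ℕ) * sgn τ (α ∘ j.succAbove)) •
      ((1 - monom (α j).1) * numerator τ (α ∘ j.succAbove))).coeff : 𝓞 F → ℤ) =
      shift ℤ (denominator α) (((-1 : ℤ) ^ (j : ℕ) * sgn τ (α ∘ j.succAbove)) •
        coneIndicator τ (α ∘ j.succAbove)) := by
    rcases eq_or_ne (embedMatrix τ (vectors (α ∘ j.succAbove))).det 0 with hj | hj
    · simp [sgn_eq_zero τ hj]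
    · rw [map_smul, AddMonoidAlgebra.coeff_smul, Finsupp.coe_smul, coeff_mul_eq_shift,
        coeff_numerator τ hn hj, ← Module.End.mul_apply, ← map_mul, ← denominator_eq_mul_succAbove]
  apply AddMonoidAlgebra.coeff_injective
  apply DFunLike.coe_injective
  rw [AddMonoidAlgebra.coeff_sum, Finsupp.coe_finsetSum, Finset.sum_congr rfl fun j _ => hterm j,
    ← map_sum, sum_sgn_smul_coneIndicator_eq_zero τ hn, map_zero]
  rfl

end GeneratingFunctions

section Symmetries

variable {F : Type u} [Field F] {n : ℕ} (τ : Fin (n + 1) ≃ (F →+* ℝ))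

lemma sgn_comp_perm (σ : Equiv.Perm (Fin (n + 1))) (α : Fin (n + 1) → primitives F) :
    sgn τ (α ∘ σ) = ((Equiv.Perm.sign σ : ℤˣ) : ℤ) * sgn τ α := by
  change (SignType.sign ((embedMatrix τ (vectors α)).submatrix id σ).det : ℤ) =
    _ * (SignType.sign (embedMatrix τ (vectors α)).det : ℤ)
  rw [Matrix.det_permute']
  rcases Int.units_eq_one_or (Equiv.Perm.sign σ) with h | h <;> simp [h, Left.sign_neg]

lemma sgn_eq_zero_of_not_injective {α : Fin (n + 1) → primitives F}
    (hα : ¬ Function.Injective α) : sgn τ α = 0 := by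
  obtain ⟨i, j, hij, hne⟩ := Function.not_injective_iff.1 hα
  exact sgn_eq_zero τ
    (Matrix.det_zero_of_column_eq hne fun k => by simp [embedMatrix, vectors, hij])

lemma sgn_smul (ε : totPosUnits F) (α : Fin (n + 1) → primitives F) :
    sgn τ (ε • α) = sgn τ α := by
  have hε (i) : 0 < embed τ ((ε : (𝓞 F)ˣ) : 𝓞 F) i := ε.2 (τ i)
  have hdiag : embedMatrix τ (vectors (ε • α)) =
      Matrix.diagonal (embed τ ((ε : (𝓞 F)ˣ) : 𝓞 F)) * embedMatrix τ (vectors α) := by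
    ext i j
    simp [embedMatrix, embed, vectors, primitives_smul_val]
  change (SignType.sign (embedMatrix τ (vectors (ε • α))).det : ℤ) =
    (SignType.sign (embedMatrix τ (vectors α)).det : ℤ)
  rw [hdiag, Matrix.det_mul, Matrix.det_diagonal, sign_mul,
    sign_pos (Finset.prod_pos fun i _ => hε i), one_mul]

lemma parallelepiped_subset_comp_perm (σ : Equiv.Perm (Fin (n + 1)))
    (α : Fin (n + 1) → primitives F) : parallelepiped τ α ⊆ parallelepiped τ (α ∘ σ) := by
  rintro _ ⟨x, hx, rfl⟩
  exact ⟨x ∘ σ, fun i => hx (σ i), (Equiv.sum_comp σ fun i => x i • embed τ ((α i).1 : F)).symm⟩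

lemma parallelepiped_comp_perm (σ : Equiv.Perm (Fin (n + 1))) (α : Fin (n + 1) → primitives F) :
    parallelepiped τ (α ∘ σ) = parallelepiped τ α := by
  refine Set.Subset.antisymm ?_ (parallelepiped_subset_comp_perm τ σ α)
  simpa [Function.comp_assoc] using parallelepiped_subset_comp_perm τ σ.symm (α ∘ σ)

lemma mul_mem_parallelepiped {α : Fin (n + 1) → primitives F} {u : Fin (n + 1) → ℝ}
    (hu : u ∈ parallelepiped τ α) (ε : totPosUnits F) :
    embed τ ((ε : (𝓞 F)ˣ) : 𝓞 F) * u ∈ parallelepiped τ (ε • α) := by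
  obtain ⟨x, hx, rfl⟩ := hu
  refine ⟨x, hx, funext fun i => ?_⟩
  simp [embed, primitives_smul_val, Finset.mul_sum, mul_left_comm]

lemma mul_mem_upperClosure {R R' : Set (Fin (n + 1) → ℝ)} {c u : Fin (n + 1) → ℝ}
    (hc : ∀ i, 0 < c i) (hR : ∀ v ∈ R, c * v ∈ R') (hu : u ∈ upperClosure R) :
    c * u ∈ upperClosure R' := by
  obtain ⟨hpos, δ, hδ, h⟩ := hu
  refine ⟨fun i => mul_pos (hc i) (hpos i), c (Fin.last n) * δ, mul_pos (hc _) hδ,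
    fun δ' hδ'0 hδ' => ?_⟩
  have hsub : c * u - Pi.single (Fin.last n) δ' =
      c * (u - Pi.single (Fin.last n) (δ' / c (Fin.last n))) := by
    rw [mul_sub, ← Pi.single_mul_right, mul_div_cancel₀ _ (hc _).ne']
  rw [hsub]
  exact hR _ (h _ (div_pos hδ'0 (hc _)) ((div_lt_iff₀' (hc _)).2 hδ'))

lemma mem_latticePoints_smul {α : Fin (n + 1) → primitives F} {β : 𝓞 F}
    (hβ : β ∈ latticePoints τ α) (ε : totPosUnits F) :
    ((ε : (𝓞 F)ˣ) : 𝓞 F) * β ∈ latticePoints τ (ε • α) := by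
  have hmul : embed τ ((((ε : (𝓞 F)ˣ) : 𝓞 F) * β : 𝓞 F) : F) =
      embed τ ((ε : (𝓞 F)ˣ) : 𝓞 F) * embed τ (β : F) := by
    funext i
    simp [embed]
  rw [latticePoints, Set.mem_ofPred_eq, hmul]
  exact mul_mem_upperClosure (fun i => ε.2 (τ i)) (fun _ hv => mul_mem_parallelepiped τ hv ε) hβ

variable [NumberField F] [IsTotallyReal F]

lemma numerator_comp_perm (σ : Equiv.Perm (Fin (n + 1))) (α : Fin (n + 1) → primitives F) :
    numerator τ (α ∘ σ) = numerator τ α := by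
  simp only [numerator, latticePoints, parallelepiped_comp_perm]

lemma actRing_numerator (ε : totPosUnits F) (α : Fin (n + 1) → primitives F) :
    actRing ε (numerator τ α) = numerator τ (ε • α) := by
  have hmem (β : 𝓞 F) : β ∈ (finite_latticePoints τ α).toFinset ↔
      Units.mulLeft (ε : (𝓞 F)ˣ) β ∈ (finite_latticePoints τ (ε • α)).toFinset := by
    rw [Set.Finite.mem_toFinset, Set.Finite.mem_toFinset]
    refine ⟨fun hβ => mem_latticePoints_smul τ hβ ε, fun hβ => ?_⟩
    simpa using mem_latticePoints_smul τ hβ ε⁻¹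
  rw [numerator, map_sum, numerator]
  exact Finset.sum_equiv _ hmem fun β _ => actRing_monom ε β

end Symmetries

section InvariantCochains

variable {G : Type u} [Group G] {X : Scheme.{u}} {ρ : RightAction G X}
  {A : Type u} [MulAction G A]

lemma EquivariantFamily.exists_cochain (𝔘 : EquivariantFamily ρ A)
    (F : Sheaf (topology ρ) AddCommGrpCat.{u}) {m : ℕ} (s : 𝔘.cochains F.obj m (whole ρ))
    (hs : ∀ g : G, 𝔘.cochainsPull F.obj m (translate ρ g) s = s) :
    ∃ z : (𝔘.equivariantCechComplex F).X m, (∀ α, 𝔘.component F z α = s.1 α) ∧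
      (𝔘.cechDiff F.obj m (whole ρ) s = 0 →
        ((𝔘.equivariantCechComplex F).d m (m + 1)).hom z = 0) := by
  let z : invariants (𝔘.cechPresheaf F.obj m) := ⟨s, hs⟩
  refine ⟨z, fun _ => rfl, fun hd => ?_⟩
  have hdiff : (𝔘.equivariantCechComplex F).d m (m + 1) =
      (equivariantSections ρ).map (𝔘.cechSheafDiff F m) := by
    rw [← cechComplex_d]
    rfl
  rw [hdiff]
  exact Subtype.ext hd

/-- Pullback of functions along a morphism of the site, as a ring homomorphism; on underlying
additive groups it is the pullback of sections of `structurePresheaf`. -/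
def pullRing {V W : QOpen ρ} (f : V ⟶ W) : Γ(X, W.carrier) →+* Γ(X, V.carrier) :=
  ((ρ.act (elt f)).appLE W.carrier V.carrier (le_preimage f)).hom

end InvariantCochains

section RestrictedSections

variable {F : Type u} [Field F]

lemma le_preimage_top {X Y : Scheme.{u}} (f : X ⟶ Y) (V : X.Opens) : V ≤ f ⁻¹ᵁ (⊤ : Y.Opens) :=
  fun _ _ => trivial

/-- An element of the coordinate ring of `𝕋` as a function on an open subset of `U`. -/
noncomputable def restrictSections (V : QOpen (puncturedAction F)) :
    CoordRing F →+* Γ((puncturedTorus F).toScheme, V.carrier) :=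
  ((Scheme.ΓSpecIso (CommRingCat.of (CoordRing F))).inv ≫
    (puncturedTorus F).ι.appLE ⊤ V.carrier (le_preimage_top _ _)).hom

lemma appLE_toSections (W : (torus F).Opens) (V : QOpen (puncturedAction F))
    (h : V.carrier ≤ (puncturedTorus F).ι ⁻¹ᵁ W) (x : CoordRing F) :
    ((puncturedTorus F).ι.appLE W V.carrier h).hom (toSections W x) = restrictSections V x := by
  have hcomp : ((Scheme.ΓSpecIso (CommRingCat.of (CoordRing F))).inv ≫
      (torus F).presheaf.map (homOfLE le_top).op) ≫ (puncturedTorus F).ι.appLE W V.carrier h =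
      (Scheme.ΓSpecIso (CommRingCat.of (CoordRing F))).inv ≫
        (puncturedTorus F).ι.appLE ⊤ V.carrier (le_preimage_top _ _) := by
    rw [Category.assoc, Scheme.Hom.map_appLE]
  exact congrArg (fun k => k.hom x) hcomp

lemma ofHom_actRing_comp_ΓSpecIso_inv (ε : totPosUnits F) :
    CommRingCat.ofHom (actRing ε) ≫ (Scheme.ΓSpecIso (CommRingCat.of (CoordRing F))).inv =
      (Scheme.ΓSpecIso (CommRingCat.of (CoordRing F))).inv ≫
        ((torusAction F).act ε).appLE ⊤ ⊤ (le_preimage_top _ _) :=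
  (Scheme.ΓSpecIso_inv_naturality (CommRingCat.ofHom (actRing ε))).trans
    (congrArg _ (Scheme.Hom.appLE_eq_app _).symm)

lemma pullRing_restrictSections {V W : QOpen (puncturedAction F)} (f : V ⟶ W) (x : CoordRing F) :
    pullRing f (restrictSections W x) = restrictSections V (actRing (elt f) x) := by
  have hι : (puncturedAction F).act (elt f) ≫ (puncturedTorus F).ι =
      (puncturedTorus F).ι ≫ (torusAction F).act (elt f) := Scheme.Hom.resLE_comp_ι ..
  have hcomp : ((Scheme.ΓSpecIso (CommRingCat.of (CoordRing F))).inv ≫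
      (puncturedTorus F).ι.appLE ⊤ W.carrier (le_preimage_top _ _)) ≫
        ((puncturedAction F).act (elt f)).appLE W.carrier V.carrier (le_preimage f) =
      CommRingCat.ofHom (actRing (elt f)) ≫ (Scheme.ΓSpecIso (CommRingCat.of (CoordRing F))).inv ≫
        (puncturedTorus F).ι.appLE ⊤ V.carrier (le_preimage_top _ _) := by
    rw [Category.assoc, Scheme.Hom.appLE_comp_appLE,
      reassoc_of% ofHom_actRing_comp_ΓSpecIso_inv (elt f), Scheme.Hom.appLE_comp_appLE]
    simp only [hι]
  exact congrArg (fun k => k.hom x) hcomp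

lemma isUnit_restrictSections_denominator {n : ℕ} (α : Fin (n + 1) → primitives F)
    {V : QOpen (puncturedAction F)}
    (h : V.carrier ≤ ((standardCover F).box (whole (puncturedAction F)) α).carrier) :
    IsUnit (restrictSections V (denominator α)) := by
  rw [← appLE_toSections _ V (h.trans (box_le_torusInter α))]
  exact (isUnit_denominator α).map _

lemma isUnit_restrictSections_denominator_of_succAbove {V : QOpen (puncturedAction F)} {n : ℕ}
    {α : Fin (n + 2) → primitives F}
    (h : ∀ j : Fin (n + 2), IsUnit (restrictSections V (denominator (α ∘ j.succAbove)))) :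
    IsUnit (restrictSections V (denominator α)) := by
  simp only [denominator, map_prod, IsUnit.prod_univ_iff] at h ⊢
  intro i
  obtain ⟨j, hj⟩ := exists_ne i
  obtain ⟨k, rfl⟩ := Fin.exists_succAbove_eq hj.symm
  exact h j k

end RestrictedSections

section ShintaniCocycle

variable {F : Type u} [Field F] [NumberField F] [IsTotallyReal F] {n : ℕ}
  (τ : Fin (n + 1) ≃ (F →+* ℝ)) {V : QOpen (puncturedAction F)}

/-- The component at `α` of the Shintani cocycle as an element of a ring, where `shintaniComponent`
only lives in the underlying additive group. -/
noncomputable def shintaniSection (α : Fin (n + 1) → primitives F) :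
    Γ((puncturedTorus F).toScheme,
      ((standardCover F).box (whole (puncturedAction F)) α).carrier) :=
  shintaniComponent τ α

lemma shintaniSection_mul_denominator (α : Fin (n + 1) → primitives F) :
    shintaniSection τ α * restrictSections _ (denominator α) =
      restrictSections _ (sgn τ α • numerator τ α) := by
  rw [← appLE_toSections _ _ (box_le_torusInter α), ← appLE_toSections _ _ (box_le_torusInter α)]
  refine (map_mul _ _ _).symm.trans (congrArg _ ?_)
  rw [signedShintani, shintaniFunction, smul_mul_assoc, mul_assoc, denominator, IsUnit.val_inv_mul,
    mul_one, map_zsmul, numerator]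

lemma pullRing_shintaniSection_mul_denominator (α : Fin (n + 1) → primitives F)
    (f : V ⟶ (standardCover F).box (whole (puncturedAction F)) α) :
    pullRing f (shintaniSection τ α) * restrictSections V (denominator (elt f • α)) =
      restrictSections V (sgn τ (elt f • α) • numerator τ (elt f • α)) := by
  have h := congrArg (pullRing f) (shintaniSection_mul_denominator τ α)
  rwa [map_mul, pullRing_restrictSections, pullRing_restrictSections, map_zsmul,
    actRing_numerator, actRing_denominator, ← sgn_smul τ (elt f) α] at h

lemma pullRing_incl_shintaniSection_mul_denominator (α : Fin (n + 1) → primitives F)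
    (h : V.carrier ≤ ((standardCover F).box (whole (puncturedAction F)) α).carrier) :
    pullRing (incl h) (shintaniSection τ α) * restrictSections V (denominator α) =
      restrictSections V (sgn τ α • numerator τ α) := by
  simpa only [elt_incl, one_smul] using pullRing_shintaniSection_mul_denominator τ α (incl h)

lemma pullRing_shintaniSection_comp_perm (σ : Equiv.Perm (Fin (n + 1)))
    (α : Fin (n + 1) → primitives F) :
    pullRing (incl ((standardCover F).box_le_comp (whole (puncturedAction F)) α σ))
      (shintaniSection τ (α ∘ σ)) =
        ((Equiv.Perm.sign σ : ℤˣ) : ℤ) • shintaniSection τ α := by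
  refine (isUnit_restrictSections_denominator α le_rfl).mul_left_injective ?_
  have h := pullRing_incl_shintaniSection_mul_denominator τ (α ∘ σ)
    ((standardCover F).box_le_comp (whole (puncturedAction F)) α σ)
  rw [denominator_comp_perm, sgn_comp_perm, numerator_comp_perm, mul_smul, map_zsmul] at h
  beta_reduce
  rw [h, smul_mul_assoc, shintaniSection_mul_denominator]

lemma shintaniComponent_mem_cochains :
    shintaniComponent τ ∈ (standardCover F).cochains
      (structureSheaf (puncturedAction F)).obj n (whole (puncturedAction F)) := by
  refine ⟨fun σ α => pullRing_shintaniSection_comp_perm τ σ α, fun α hα => ?_⟩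
  rw [shintaniComponent, signedShintani, sgn_eq_zero_of_not_injective τ hα, zero_smul]
  exact map_zero _

/-- The family of the functions `sgn(α) 𝒢_{σ_α}`, as an alternating cochain. -/
noncomputable def shintaniCochain : (standardCover F).cochains
    (structureSheaf (puncturedAction F)).obj n (whole (puncturedAction F)) :=
  ⟨shintaniComponent τ, shintaniComponent_mem_cochains τ⟩

lemma cochainsPull_shintaniCochain (ε : totPosUnits F) :
    (standardCover F).cochainsPull (structureSheaf (puncturedAction F)).obj n
      (translate (puncturedAction F) ε) (shintaniCochain τ) = shintaniCochain τ := by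
  refine Subtype.ext (funext fun α => ?_)
  refine (isUnit_restrictSections_denominator α le_rfl).mul_left_injective ?_
  have h : pullRing ((standardCover F).boxHom (translate (puncturedAction F) ε) α)
      (shintaniSection τ (ε⁻¹ • α)) * restrictSections _ (denominator (ε • ε⁻¹ • α)) =
        restrictSections _ (sgn τ (ε • ε⁻¹ • α) • numerator τ (ε • ε⁻¹ • α)) :=
    pullRing_shintaniSection_mul_denominator τ (ε⁻¹ • α) _
  rw [smul_inv_smul] at h
  exact h.trans (shintaniSection_mul_denominator τ α).symm

lemma sum_pullRing_shintaniSection_eq_zero (hn : finrank ℚ F = n + 1)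
    {α : Fin (n + 2) → primitives F} (hV : ∀ j : Fin (n + 2), V.carrier ≤
      ((standardCover F).box (whole (puncturedAction F)) (α ∘ j.succAbove)).carrier) :
    ∑ j : Fin (n + 2), (-1 : ℤ) ^ (j : ℕ) •
      pullRing (incl (hV j)) (shintaniSection τ (α ∘ j.succAbove)) = 0 := by
  have hunit : IsUnit (restrictSections V (denominator α)) :=
    isUnit_restrictSections_denominator_of_succAbove fun j =>
      isUnit_restrictSections_denominator _ (hV j)
  have hmul (j : Fin (n + 2)) :
      pullRing (incl (hV j)) (shintaniSection τ (α ∘ j.succAbove)) *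
        restrictSections V (denominator α) =
      sgn τ (α ∘ j.succAbove) •
        restrictSections V ((1 - monom (α j).1) * numerator τ (α ∘ j.succAbove)) := by
    rw [denominator_eq_mul_succAbove α j, map_mul, mul_left_comm,
      pullRing_incl_shintaniSection_mul_denominator, map_zsmul, mul_smul_comm, map_mul]
  refine hunit.mul_left_injective ?_
  have hsum := congrArg (restrictSections V) (sum_sgn_smul_numerator_eq_zero τ hn α)
  simp only [map_sum, map_zsmul, map_zero, mul_smul] at hsum
  simp only [Finset.sum_mul, smul_mul_assoc, hmul, zero_mul, hsum]

lemma cechDiff_shintaniCochain (hn : finrank ℚ F = n + 1) :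
    (standardCover F).cechDiff (structureSheaf (puncturedAction F)).obj n
      (whole (puncturedAction F)) (shintaniCochain τ) = 0 :=
  Subtype.ext <| funext fun α => sum_pullRing_shintaniSection_eq_zero τ hn
    ((standardCover F).box_le_comp (whole (puncturedAction F)) α ·.succAbove)

end ShintaniCocycle

end Shintani

theorem proposition4p2 {F : Type*} [Field F] [NumberField F] [NumberField.IsTotallyReal F]
    {n : ℕ} (hn : Module.finrank ℚ F = n + 1) (τ : Fin (n + 1) ≃ (F →+* ℝ)) :
    ∃ 𝒢 : ((Shintani.standardCover F).equivariantCechComplex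
        (Shintani.structureSheaf (Shintani.puncturedAction F))).X n,
      (∀ α : Fin (n + 1) → Shintani.primitives F,
        (Shintani.standardCover F).component
            (Shintani.structureSheaf (Shintani.puncturedAction F)) 𝒢 α =
          Shintani.shintaniComponent τ α) ∧
      (((Shintani.standardCover F).equivariantCechComplex
        (Shintani.structureSheaf (Shintani.puncturedAction F))).d n (n + 1)).hom 𝒢 = 0 ∧
      ∃! c : Shintani.equivariantCohomology (Shintani.puncturedAction F) n
          (Shintani.structureSheaf (Shintani.puncturedAction F)),
        (Shintani.standardCover F).IsClassOf
          (Shintani.structureSheaf (Shintani.puncturedAction F)) 𝒢 c := by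
  obtain ⟨𝒢, h𝒢, hd⟩ := (Shintani.standardCover F).exists_cochain
    (Shintani.structureSheaf (Shintani.puncturedAction F)) (Shintani.shintaniCochain τ)
    (Shintani.cochainsPull_shintaniCochain τ)
  have hcocycle := hd (Shintani.cechDiff_shintaniCochain τ hn)
  have hres := (Shintani.standardCover F).isResolution_cechAugmentation
    (Shintani.structureSheaf (Shintani.puncturedAction F)) Shintani.exists_mem_standardCover_opens
  exact ⟨𝒢, h𝒢, hcocycle, (Shintani.standardCover F).existsUnique_isClassOf hres hcocycle⟩
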